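/- Let $n\ge 1$, let $V,W$ be finite-dimensional real inner product spaces, let $B_1,\dots,B_n\in\mathrm{Lin}(V;W)$, and let $\mathcal B[D]u=\sum_{i=1}^n B_i\,\partial_i u$ be the associated first-order operator. Assume that $\mathcal B[D]$ is $\mathbb C$-elliptic, that is, for every $\xi\in\mathbb C^n\setminus\{0\}$ the complexified symbol $\sum_i \xi_i B_i:\mathbb C\otimes V\to\mathbb C\otimes W$ is injective. For an open set $\Omega\subset\mathbb R^n$ let $\mathrm{BV}^{\mathcal B}(\Omega)$ be the space of all $u\in L^1(\Omega;V)$ for which there is a finite $W$-valued Radon measure $\mathcal Bu$ on $\Omega$ with $$\int_\Omega \varphi\cdot \mathrm d\mathcal Bu=\int_\Omega \mathcal B^*\varphi\cdot u\,\mathrm dx\quad\text{for all }\varphi\in C_c^\infty(\Omega;W),\qquad \mathcal B^*\varphi=-\sum_i B_i^*\,\partial_i\varphi .$$ Let $|\mathcal Bu|$ be its total variation measure, let $B_r(x)$ be the open ball, and let $$\Theta_u=\Big\{x\in\Omega:\ \limsup_{r\downarrow0}\frac{|\mathcal Bu|(B_r(x))}{r^{n-1}}>0\Big\}.$$ Proposition.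 There are $\ell\in\mathbb N_0$ and $c>0$, depending only on $\mathcal B$ (including $n,V,W$), such that for every open $\Omega\subset\mathbb R^n$ and every $u\in\mathrm{BV}^{\mathcal B}(\Omega)$ the following holds. There are vectors $a_\beta(x,r)\in V$ ($x\in\Omega$, $r>0$, $\beta\in\mathbb N_0^n$ with $|\beta|\le \ell-1$) such that the $V$-valued polynomials of degree at most $\ell-1$ $$p_{x,r}(y)=\sum_{|\beta|\le \ell-1}a_\beta(x,r)\,(y-x)^\beta$$ satisfy $$\frac{1}{|B_r(x)|}\int_{B_r(x)}|u(y)-p_{x,r}(y)|\,\mathrm dy\ \le\ c\,\frac{|\mathcal Bu|(B_r(x))}{r^{n-1}}\qquad\text{whenever } x\in\Omega,\ r>0,\ B_r(x)\subset\Omega,$$ and, for all $x\in\Omega\setminus\Theta_u$, $$\lim_{r\downarrow0} r^{|\beta|}a_\beta(x,r)=0\qquad\text{for all } 1\le|\beta|\le \ell-1 .$$ Moreover, $$\lim_{r\downarrow0}\ \inf_{z\in V}\ \frac{1}{|B_r(x)|}\int_{B_r(x)}|u(y)-z|\,\mathrm dy=0\qquad\text{for all }x\in\Omega\setminus\Theta_u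 .$$ -/

import Mathlib

open MeasureTheory Filter Topology
open scoped ENNReal ContDiff TensorProduct

namespace QuasiCont

noncomputable section

/-! A first-order homogeneous operator with constant coefficients, `𝓑[D] u = ∑ᵢ Bᵢ ∂ᵢ u`, acting on
`V`-valued maps on `ℝⁿ` and producing `W`-valued maps, is given by its coefficients
`B : Fin n → Lin(V, W)`. -/

/-- The complexified principal symbol `𝔹(ξ) = ∑ᵢ ξᵢ Bᵢ : ℂ ⊗ V → ℂ ⊗ W` at `ξ ∈ ℂⁿ`. -/
def complexSymbol {n : ℕ} {V W : Type*} [AddCommGroup V] [Module ℝ V]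
    [AddCommGroup W] [Module ℝ W] (B : Fin n → V →ₗ[ℝ] W) (ξ : Fin n → ℂ) :
    (ℂ ⊗[ℝ] V) →ₗ[ℂ] (ℂ ⊗[ℝ] W) :=
  ∑ i, ξ i • (B i).baseChange ℂ

/-- `ℂ`-ellipticity: the complexified principal symbol is injective at every `ξ ∈ ℂⁿ \ {0}`. -/
def IsCElliptic {n : ℕ} {V W : Type*} [AddCommGroup V] [Module ℝ V]
    [AddCommGroup W] [Module ℝ W] (B : Fin n → V →ₗ[ℝ] W) : Prop :=
  ∀ ξ : Fin n → ℂ, ξ ≠ 0 → Function.Injective (complexSymbol B ξ)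

/-- The formal adjoint `𝓑*[D] φ = -∑ᵢ Bᵢ* ∂ᵢ φ`. -/
def adjointOp {n : ℕ} {V W : Type*}
    [NormedAddCommGroup V] [InnerProductSpace ℝ V] [FiniteDimensional ℝ V]
    [NormedAddCommGroup W] [InnerProductSpace ℝ W] [FiniteDimensional ℝ W]
    (B : Fin n → V →ₗ[ℝ] W) (φ : EuclideanSpace ℝ (Fin n) → W)
    (x : EuclideanSpace ℝ (Fin n)) : V :=
  -∑ i, LinearMap.adjoint (B i) (fderiv ℝ φ x (EuclideanSpace.single i 1))

/-- `u ∈ BV^𝓑(Ω)` with `𝓑u = μ`: the map `u` is in `L¹(Ω; V)` and its distributional `𝓑`-gradient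
on `Ω` is the (finite) `W`-valued Borel measure `μ`. Measures on `Ω` are encoded as measures on
`ℝⁿ` that are concentrated on `Ω`. -/
structure IsBVWithGradient {n : ℕ} {V W : Type*}
    [NormedAddCommGroup V] [InnerProductSpace ℝ V] [FiniteDimensional ℝ V]
    [NormedAddCommGroup W] [InnerProductSpace ℝ W] [FiniteDimensional ℝ W]
    (B : Fin n → V →ₗ[ℝ] W) (Ω : Set (EuclideanSpace ℝ (Fin n)))
    (u : EuclideanSpace ℝ (Fin n) → V)
    (μ : VectorMeasure (EuclideanSpace ℝ (Fin n)) W) : Prop where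
  integrableOn : IntegrableOn u Ω volume
  concentrated : μ.restrict Ω = μ
  integral_eq : ∀ φ : EuclideanSpace ℝ (Fin n) → W,
    ContDiff ℝ ∞ φ → HasCompactSupport φ → tsupport φ ⊆ Ω →
      μ.integral φ (innerSL ℝ) = ∫ x in Ω, inner ℝ (adjointOp B φ x) (u x)

/-- A vector measure with values in a finite-dimensional inner product space has finite total
variation; hence the real number `μ.variation.real s` is the total variation `|μ|(s)`. -/
theorem isFiniteMeasure_variation {X W : Type*} [MeasurableSpace X]
    [NormedAddCommGroup W] [InnerProductSpace ℝ W] [FiniteDimensional ℝ W]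
    (μ : VectorMeasure X W) : IsFiniteMeasure μ.variation := by
  let b := stdOrthonormalBasis ℝ W
  let ν : Fin (Module.finrank ℝ W) → SignedMeasure X := fun i =>
    μ.mapRange (innerSL ℝ (b i)).toLinearMap.toAddMonoidHom (innerSL ℝ (b i)).continuous
  let m : Measure X := ∑ i, (ν i).totalVariation
  have hm : IsFiniteMeasure m := by
    refine ⟨?_⟩
    simp only [m, Measure.coe_finsetSum, Finset.sum_apply]
    exact ENNReal.sum_lt_top.2 fun i _ => measure_lt_top _ _
  refine isFiniteMeasure_of_le m (VectorMeasure.variation_le_of_forall_enorm_le fun s _ => ?_)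
  have h1 : μ s = ∑ i, (ν i s) • b i := (b.sum_repr' (μ s)).symm
  calc ‖μ s‖ₑ ≤ ∑ i, ‖(ν i s) • b i‖ₑ := by
        conv_lhs => rw [h1]
        exact enorm_sum_le _ _
    _ ≤ ∑ i, (ν i).totalVariation s := by
        refine Finset.sum_le_sum fun i _ => ?_
        have h2 : ‖b i‖ₑ = 1 := by
          rw [← ofReal_norm, b.norm_eq_one i, ENNReal.ofReal_one]
        rw [enorm_smul, h2, mul_one]
        exact SignedMeasure.enorm_le_totalVariation _ _
    _ = m s := by simp [m]

/-- The set `Θ` of points of `Ω` at which the total variation `|μ|` has positive upper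
`(n-1)`-dimensional density. -/
def densitySet {n : ℕ} {W : Type*} [NormedAddCommGroup W]
    (Ω : Set (EuclideanSpace ℝ (Fin n)))
    (μ : VectorMeasure (EuclideanSpace ℝ (Fin n)) W) : Set (EuclideanSpace ℝ (Fin n)) :=
  {x ∈ Ω | 0 < limsup (fun r : ℝ =>
    μ.variation (Metric.ball x r) / ENNReal.ofReal (r ^ (n - 1))) (𝓝[>] 0)}

/-- The finite set of multi-indices `β ∈ ℕⁿ` with `|β| ≤ ℓ - 1`, that is, `|β| < ℓ`. -/
def multiIndices (n ℓ : ℕ) : Finset (Fin n → ℕ) :=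
  (Fintype.piFinset fun _ => Finset.range ℓ).filter fun β => ∑ i, β i < ℓ

theorem mem_multiIndices {n ℓ : ℕ} {β : Fin n → ℕ} :
    β ∈ multiIndices n ℓ ↔ ∑ i, β i < ℓ := by
  simp only [multiIndices, Finset.mem_filter, Fintype.mem_piFinset, Finset.mem_range,
    and_iff_right_iff_imp]
  exact fun h i => (Finset.single_le_sum (fun j _ => Nat.zero_le (β j))
    (Finset.mem_univ i)).trans_lt h

/-- The `V`-valued polynomial `y ↦ ∑_{|β| ≤ ℓ-1} a_β (y - x)^β`, of degree at most `ℓ - 1`. -/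
def centredPolynomial {n : ℕ} {V : Type*} [AddCommGroup V] [Module ℝ V] (ℓ : ℕ)
    (x : EuclideanSpace ℝ (Fin n)) (a : (Fin n → ℕ) → V)
    (y : EuclideanSpace ℝ (Fin n)) : V :=
  ∑ β ∈ multiIndices n ℓ, (∏ i, (y i - x i) ^ β i) • a β

end

end QuasiCont

/-! The proof combines an algebraic consequence of `ℂ`-ellipticity with an averaged Taylor
polynomial whose remainder is controlled by the `𝓑`-gradient.

Algebra. The complex symbol is injective off the origin, so the cokernel of its transpose, a module
over the polynomial ring, is supported at the origin. The Nullstellensatz and Nakayama's lemma then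
show that a power of the irrelevant ideal kills it (`exists_pow_le_annihilator`). Read with `Xᵢ`
acting as `∂ᵢ`: a sufficiently high derivative of a test function, times a fixed vector, is `𝓑*φ`
for a test function `φ` supported in the same ball (`IsCElliptic.exists_adjointOp_eq`).

Poincaré inequality. Let `K_y` be the kernel of the averaged Taylor polynomial at `y`, and contract
it towards `y` by a factor `s`. At `s = 1`, integrating `u` against it gives a polynomial in `y`; as
`s → 0` it gives `u(y)` at Lebesgue points. The sum defining `K_y` telescopes under `d/ds`, leaving
only a term made of derivatives of order `L + 1`, which has a potential. Testing the definition of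
`𝓑u` with that potential bounds the change between consecutive dyadic scales by `|𝓑u|` of a small
ball around `y`. Summing over scales and integrating in `y` gives
`IsBVWithGradient.lintegral_enorm_sub_le`.

Decay. The kernels of the coefficients with `β ≠ 0` have integral zero, so `r^|β| a_β` is bounded by
a multiple of the mean oscillation on `B_r(x)` (`norm_smul_taylorCoeff_le`). On `B_{θr}(x)` the
nonconstant part of the polynomial gains a factor `θ`, so for small fixed `θ` the oscillation at
`θr` is at most half that at `r` plus a multiple of the density `|𝓑u|(B_r)/r^(n-1)`. Where the
density tends to zero, iteration makes the oscillation vanish (`tendsto_zero_of_dilation_le`), and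
with it the coefficients. -/

namespace QuasiCont

noncomputable section

/-! ### Algebra of the symbol: Nullstellensatz and descent from `ℂ` to `ℝ`. -/

open MvPolynomial in
/-- The coefficientwise real part of a complex polynomial. -/
def polyRe {σ : Type*} : MvPolynomial σ ℂ →ₗ[ℝ] MvPolynomial σ ℝ :=
  (basisMonomials σ ℝ).repr.symm.toLinearMap ∘ₗ Finsupp.mapRange.linearMap Complex.reLm ∘ₗ
    ((basisMonomials σ ℂ).repr.restrictScalars ℝ).toLinearMap

open MvPolynomial in
theorem coeff_polyRe {σ : Type*} (p : MvPolynomial σ ℂ) (m : σ →₀ ℕ) :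
    coeff m (polyRe p) = (coeff m p).re := rfl

open MvPolynomial in
theorem polyRe_X_mul {σ : Type*} (i : σ) (p : MvPolynomial σ ℂ) :
    polyRe (X i * p) = X i * polyRe p := by
  classical
  ext m
  simp only [coeff_polyRe, coeff_X_mul']
  split_ifs <;> simp

open MvPolynomial in
theorem polyRe_C_mul {σ : Type*} (c : ℝ) (p : MvPolynomial σ ℂ) :
    polyRe (C (c : ℂ) * p) = C c * polyRe p := by
  ext m
  simp [coeff_polyRe, coeff_C_mul]

open MvPolynomial in
theorem polyRe_map {σ : Type*} (p : MvPolynomial σ ℝ) :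
    polyRe (map (algebraMap ℝ ℂ) p) = p := by
  ext m
  simp [coeff_polyRe, coeff_map]

/-- The matrix `∑ᵢ Xᵢ Aᵢ` of linear forms. -/
def symbolMatrix {σ ι κ k : Type*} [Fintype σ] [CommSemiring k] (A : σ → Matrix κ ι k) :
    Matrix κ ι (MvPolynomial σ k) :=
  ∑ i, (MvPolynomial.X i : MvPolynomial σ k) • (A i).map MvPolynomial.C

theorem symbolMatrix_apply {σ ι κ k : Type*} [Fintype σ] [CommSemiring k] (A : σ → Matrix κ ι k)
    (j : κ) (a : ι) :
    symbolMatrix A j a = ∑ i, MvPolynomial.X i * MvPolynomial.C (A i j a) := by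
  simp [symbolMatrix, Matrix.sum_apply]

/-- If the matrix `∑ᵢ ξᵢ Aᵢ` has a left inverse at every `ξ ≠ 0`, then the cokernel of its
transpose is annihilated by a power of the irrelevant ideal. -/
theorem exists_pow_le_annihilator {σ ι κ k : Type*} [Field k] [IsAlgClosed k]
    [Fintype σ] [Fintype ι] [Fintype κ] [DecidableEq ι]
    (A : σ → Matrix κ ι k)
    (hA : ∀ ξ : σ → k, ξ ≠ 0 → ∃ N : Matrix ι κ k, N * ∑ i, ξ i • A i = 1) :
    ∃ ℓ : ℕ, Ideal.span (Set.range (MvPolynomial.X : σ → MvPolynomial σ k)) ^ ℓ ≤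
      Module.annihilator (MvPolynomial σ k)
        ((ι → MvPolynomial σ k) ⧸ LinearMap.range (symbolMatrix A).vecMulLinear) := by
  classical
  set S := LinearMap.range (symbolMatrix A).vecMulLinear with hS
  apply Ideal.exists_pow_le_of_le_radical_of_fg _ ⟨Finset.univ.image MvPolynomial.X, by simp⟩
  -- By the Nullstellensatz it suffices that the annihilator has no zero other than the origin.
  rw [Ideal.span_le, ← MvPolynomial.vanishingIdeal_zeroLocus_eq_radical (K := k)]
  rintro _ ⟨i, rfl⟩
  intro ξ hξ
  rw [MvPolynomial.aeval_X]
  by_contra hi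
  obtain ⟨N, hN⟩ := hA ξ (fun h => hi (by rw [h]; rfl))
  set I : Ideal (MvPolynomial σ k) := MvPolynomial.vanishingIdeal k {ξ} with hI
  -- With `I` the maximal ideal of `ξ`, row `a` of the left inverse `N` gives an element of `S`
  -- whose value at `ξ` is the basis vector `e_a`. Hence `e_a` lies in `I • M` for the cokernel `M`.
  have hmem : ∀ a : ι, Submodule.Quotient.mk (p := S) (Pi.single a 1) ∈
      I • (⊤ : Submodule (MvPolynomial σ k) ((ι → MvPolynomial σ k) ⧸ S)) := by
    intro a
    have h1 : Submodule.Quotient.mk (p := S) (Pi.single a 1) =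
        Submodule.Quotient.mk (p := S) (Pi.single a 1 -
          (symbolMatrix A).vecMulLinear (fun j => MvPolynomial.C (N a j))) := by
      rw [Submodule.Quotient.eq]
      simp [hS]
    rw [h1]
    have h2 : Pi.single a 1 - (symbolMatrix A).vecMulLinear (fun j => MvPolynomial.C (N a j)) =
        ∑ b, ((Pi.single a 1 - (symbolMatrix A).vecMulLinear
          (fun j => MvPolynomial.C (N a j)) : ι → MvPolynomial σ k) b) •
          (Pi.single b 1 : ι → MvPolynomial σ k) := by
      exact (pi_eq_sum_univ' _).trans (by simp [Pi.single, Function.update, eq_comm, Pi.sub_apply])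
    rw [h2, ← Submodule.mkQ_apply, map_sum]
    refine Submodule.sum_mem _ fun b _ => ?_
    rw [map_smul]
    refine Submodule.smul_mem_smul ?_ Submodule.mem_top
    rw [hI, MvPolynomial.mem_vanishingIdeal_singleton_iff]
    have h3 := congrFun (congrFun hN a) b
    simp only [Matrix.mul_apply, Matrix.sum_apply, Matrix.smul_apply, smul_eq_mul,
      Matrix.one_apply] at h3
    simp only [Pi.sub_apply, Matrix.vecMulLinear_apply, Matrix.vecMul, dotProduct,
      symbolMatrix_apply, map_sub, map_sum, map_mul, MvPolynomial.aeval_X,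
      MvPolynomial.aeval_C, Algebra.algebraMap_self, RingHom.id_apply, h3]
    rw [Pi.single_apply]
    by_cases hab : a = b
    · simp [hab]
    · simp [hab, Ne.symm hab]
  -- Nakayama: `M = I • M` yields `r` killing `M` with `r(ξ) = 1`, whereas `ξ` is a zero of the
  -- annihilator.
  obtain ⟨r, hr1, hr⟩ := Submodule.exists_sub_one_mem_and_smul_eq_zero_of_fg_of_le_smul I
    (⊤ : Submodule (MvPolynomial σ k) ((ι → MvPolynomial σ k) ⧸ S)) Module.Finite.fg_top (by
      rintro m -
      obtain ⟨v, rfl⟩ := Submodule.Quotient.mk_surjective S m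
      rw [pi_eq_sum_univ' v, ← Submodule.mkQ_apply, map_sum]
      refine Submodule.sum_mem _ fun b _ => ?_
      rw [map_smul]
      refine Submodule.smul_mem _ _ ?_
      convert hmem b using 1
      simp [Pi.single, Submodule.mkQ_apply])
  have h0 : MvPolynomial.aeval ξ r = 0 := by
    refine hξ r (Module.mem_annihilator.2 fun m => hr m Submodule.mem_top)
  rw [hI, MvPolynomial.mem_vanishingIdeal_singleton_iff, map_sub, h0] at hr1
  simp at hr1

/-- Real version of `exists_pow_le_annihilator`, the hypothesis being made over `ℂ`. -/
theorem exists_pow_forall_vecMul_eq {σ ι κ : Type*}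
    [Fintype σ] [Fintype ι] [Fintype κ] [DecidableEq ι]
    (A : σ → Matrix κ ι ℝ)
    (hA : ∀ ξ : σ → ℂ, ξ ≠ 0 → ∃ N : Matrix ι κ ℂ,
      N * ∑ i, ξ i • (A i).map (algebraMap ℝ ℂ) = 1) :
    ∃ ℓ : ℕ, ∀ p ∈ Ideal.span (Set.range (MvPolynomial.X : σ → MvPolynomial σ ℝ)) ^ ℓ, ∀ a : ι,
      ∃ q : κ → MvPolynomial σ ℝ, ∀ b, ∑ j, q j * symbolMatrix A j b = if a = b then p else 0 := by
  obtain ⟨ℓ, hℓ⟩ := exists_pow_le_annihilator (fun i => (A i).map (algebraMap ℝ ℂ)) hA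
  refine ⟨ℓ, fun p hp a => ?_⟩
  have h1 : MvPolynomial.map (algebraMap ℝ ℂ) p ∈
      Ideal.span (Set.range (MvPolynomial.X : σ → MvPolynomial σ ℂ)) ^ ℓ := by
    have := Ideal.mem_map_of_mem (MvPolynomial.map (algebraMap ℝ ℂ)) hp
    rw [Ideal.map_pow, Ideal.map_span, ← Set.range_comp] at this
    simpa [Function.comp_def] using this
  have h2 := Module.mem_annihilator.1 (hℓ h1) (Submodule.Quotient.mk (Pi.single a 1))
  rw [← Submodule.Quotient.mk_smul, Submodule.Quotient.mk_eq_zero] at h2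
  obtain ⟨q, hq⟩ := h2
  -- The system has real coefficients and a real right-hand side, so the real part of a complex
  -- solution is again a solution.
  refine ⟨fun j => polyRe (q j), fun b => ?_⟩
  have h3 := congrArg polyRe (congrFun hq b)
  simp only [Matrix.vecMulLinear_apply, Matrix.vecMul, dotProduct, symbolMatrix_apply,
    Finset.mul_sum, map_sum, Pi.smul_apply, smul_eq_mul, Matrix.map_apply] at h3
  have h4 : ∀ j i, polyRe (q j * (MvPolynomial.X i * MvPolynomial.C ((algebraMap ℝ ℂ) (A i j b)))) =
      polyRe (q j) * (MvPolynomial.X i * MvPolynomial.C (A i j b)) := by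
    intro j i
    rw [mul_comm, mul_assoc, polyRe_X_mul, mul_comm]
    rw [show (algebraMap ℝ ℂ) (A i j b) = ((A i j b : ℝ) : ℂ) from rfl, polyRe_C_mul]
    ring
  simp only [h4] at h3
  simp only [symbolMatrix_apply, Finset.mul_sum, h3, Pi.single_apply]
  by_cases hab : a = b
  · simp [hab, polyRe_map]
  · simp [hab, Ne.symm hab]

theorem IsCElliptic.exists_leftInverse {n : ℕ} {V W ι κ : Type*} [AddCommGroup V] [Module ℝ V]
    [AddCommGroup W] [Module ℝ W] [Fintype ι] [Fintype κ] [DecidableEq ι] [DecidableEq κ]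
    {B : Fin n → V →ₗ[ℝ] W} (hB : IsCElliptic B)
    (v : Module.Basis ι ℝ V) (w : Module.Basis κ ℝ W) (ξ : Fin n → ℂ) (hξ : ξ ≠ 0) :
    ∃ N : Matrix ι κ ℂ,
      N * ∑ i, ξ i • (LinearMap.toMatrix v w (B i)).map (algebraMap ℝ ℂ) = 1 := by
  obtain ⟨g, hg⟩ := (complexSymbol B ξ).exists_leftInverse_of_injective
    (LinearMap.ker_eq_bot.2 (hB ξ hξ))
  let v' := Algebra.TensorProduct.basis ℂ v
  let w' := Algebra.TensorProduct.basis ℂ w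
  refine ⟨LinearMap.toMatrix w' v' g, ?_⟩
  have h : ∑ i, ξ i • (LinearMap.toMatrix v w (B i)).map (algebraMap ℝ ℂ) =
      LinearMap.toMatrix v' w' (complexSymbol B ξ) := by
    simp only [complexSymbol, map_sum, map_smul, v', w', LinearMap.toMatrix_baseChange]
  rw [h, ← LinearMap.toMatrix_comp, hg, LinearMap.toMatrix_id]

/-! ### Test functions as a module over constant-coefficient differential operators. -/

/-- Smooth real functions on `ℝⁿ` vanishing outside the closed ball of radius `1/2`. -/
def TestSpace (n : ℕ) : Submodule ℝ (EuclideanSpace ℝ (Fin n) → ℝ) where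
  carrier := {f | ContDiff ℝ ∞ f ∧ ∀ z, z ∉ Metric.closedBall 0 (1 / 2) → f z = 0}
  zero_mem' := ⟨contDiff_const, fun _ _ => rfl⟩
  add_mem' hf hg := ⟨hf.1.add hg.1, fun z hz => by simp [hf.2 z hz, hg.2 z hz]⟩
  smul_mem' c f hf := ⟨contDiff_const.smul hf.1, fun z hz => by simp [hf.2 z hz]⟩

namespace TestSpace

variable {n : ℕ}

theorem contDiff (f : TestSpace n) : ContDiff ℝ ∞ (f : EuclideanSpace ℝ (Fin n) → ℝ) := f.2.1

theorem differentiable (f : TestSpace n) :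
    Differentiable ℝ (f : EuclideanSpace ℝ (Fin n) → ℝ) :=
  (TestSpace.contDiff f).differentiable (by simp)

theorem continuous (f : TestSpace n) : Continuous (f : EuclideanSpace ℝ (Fin n) → ℝ) :=
  (TestSpace.contDiff f).continuous

theorem eq_zero (f : TestSpace n) {z : EuclideanSpace ℝ (Fin n)} (hz : 1 / 2 < ‖z‖) :
    f.1 z = 0 := f.2.2 z (by simpa using hz)

theorem hasCompactSupport (f : TestSpace n) :
    HasCompactSupport (f : EuclideanSpace ℝ (Fin n) → ℝ) :=
  HasCompactSupport.intro (isCompact_closedBall 0 (1 / 2)) f.2.2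

theorem exists_bound (f : TestSpace n) : ∃ C, 0 ≤ C ∧ ∀ z, |f.1 z| ≤ C := by
  obtain ⟨C, hC⟩ := (TestSpace.hasCompactSupport f).exists_bound_of_continuous (TestSpace.continuous f)
  exact ⟨C, (norm_nonneg _).trans (hC 0), hC⟩

/-- The partial derivative `∂ᵢ` on test functions. -/
def pd (i : Fin n) : TestSpace n →ₗ[ℝ] TestSpace n where
  toFun f := ⟨fun z => fderiv ℝ f.1 z (EuclideanSpace.single i 1),
    ((TestSpace.contDiff f).fderiv_right (m := ∞) (by simp)).clm_apply contDiff_const, fun z hz => by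
      have : f.1 =ᶠ[𝓝 z] fun _ => 0 :=
        Filter.eventually_of_mem (Metric.isClosed_closedBall.isOpen_compl.mem_nhds hz)
          (fun w hw => f.2.2 w hw)
      simp [this.fderiv_eq]⟩
  map_add' f g := by
    ext z
    simp [fderiv_add ((TestSpace.differentiable f) z) ((TestSpace.differentiable g) z)]
  map_smul' c f := by
    ext z
    simp [fderiv_const_smul ((TestSpace.differentiable f) z)]

theorem pd_apply (i : Fin n) (f : TestSpace n) (z : EuclideanSpace ℝ (Fin n)) :
    (pd i f).1 z = fderiv ℝ f.1 z (EuclideanSpace.single i 1) := rfl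

theorem pd_comm (i j : Fin n) (f : TestSpace n) : pd i (pd j f) = pd j (pd i f) := by
  ext z
  have h2 : ∀ k l, (pd k (pd l f)).1 z =
      fderiv ℝ (fderiv ℝ f.1) z (EuclideanSpace.single k 1) (EuclideanSpace.single l 1) := by
    intro k l
    rw [pd_apply]
    have : (pd l f).1 = fun z => fderiv ℝ f.1 z (EuclideanSpace.single l 1) := rfl
    rw [this, fderiv_clm_apply]
    · simp
    · exact (((TestSpace.contDiff f).fderiv_right (m := ∞) (by simp)).differentiable (by simp)) z
    · simp
  rw [h2, h2]
  exact ((TestSpace.contDiff f).contDiffAt.isSymmSndFDerivAt (by simpa using ENat.LEInfty.out)) _ _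

/-- Multiplication by the coordinate `zᵢ - yᵢ`. -/
def coordMul (y : EuclideanSpace ℝ (Fin n)) (i : Fin n) : TestSpace n →ₗ[ℝ] TestSpace n where
  toFun f := ⟨fun z => (z i - y i) * f.1 z, by
    have : ContDiff ℝ ∞ fun z : EuclideanSpace ℝ (Fin n) => z i - y i :=
      (contDiff_euclidean.1 contDiff_id i).sub contDiff_const
    exact this.mul (TestSpace.contDiff f), fun z hz => by simp [f.2.2 z hz]⟩
  map_add' f g := by ext z; simp [mul_add]
  map_smul' c f := by ext z; simp [mul_left_comm]

theorem coordMul_apply (y : EuclideanSpace ℝ (Fin n)) (i : Fin n) (f : TestSpace n)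
    (z : EuclideanSpace ℝ (Fin n)) : (coordMul y i f).1 z = (z i - y i) * f.1 z := rfl

theorem pd_coordMul (y : EuclideanSpace ℝ (Fin n)) (i j : Fin n) (f : TestSpace n) :
    pd i (coordMul y j f) = (if i = j then f else 0) + coordMul y j (pd i f) := by
  ext z
  have h1 : HasFDerivAt (fun z : EuclideanSpace ℝ (Fin n) => z j - y j)
      (EuclideanSpace.proj j : EuclideanSpace ℝ (Fin n) →L[ℝ] ℝ) z :=
    (EuclideanSpace.proj j : EuclideanSpace ℝ (Fin n) →L[ℝ] ℝ).hasFDerivAt.sub_const _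
  have h2 := h1.mul ((TestSpace.differentiable f) z).hasFDerivAt
  rw [pd_apply]
  have h3 : (coordMul y j f).1 = (fun z => z j - y j) * f.1 := rfl
  rw [h3, h2.fderiv]
  by_cases hij : i = j
  · subst hij; simp [pd_apply, coordMul_apply]; ring
  · simp [pd_apply, coordMul_apply, hij, Ne.symm hij]

theorem sum_coordMul_pd_apply (y : EuclideanSpace ℝ (Fin n)) (f : TestSpace n)
    (z : EuclideanSpace ℝ (Fin n)) :
    (∑ i, coordMul y i (pd i f)).1 z = fderiv ℝ f.1 z (z - y) := by
  have h : z - y = ∑ i, (z i - y i) • EuclideanSpace.single i (1 : ℝ) := by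
    ext j
    simp [Finset.sum_apply, Pi.single_apply]
  conv_rhs => rw [h, map_sum]
  simp [Finset.sum_apply, coordMul_apply, pd_apply]

theorem integral_pd (i : Fin n) (f : TestSpace n) : ∫ z, (pd i f).1 z = 0 := by
  have h1 : Integrable (pd i f).1 :=
    (TestSpace.continuous (pd i f)).integrable_of_hasCompactSupport (TestSpace.hasCompactSupport (pd i f))
  have h2 : Integrable f.1 := (TestSpace.continuous f).integrable_of_hasCompactSupport (TestSpace.hasCompactSupport f)
  have h := integral_mul_fderiv_eq_neg_fderiv_mul_of_integrable (μ := volume) (𝕜 := ℝ)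
    (f := fun _ : EuclideanSpace ℝ (Fin n) => (1 : ℝ)) (g := f.1)
    (v := EuclideanSpace.single i (1 : ℝ)) (by simp)
    (by simpa only [one_mul] using! h1) (by simpa only [one_mul] using h2) (by intros; fun_prop)
    (fun x _ => (TestSpace.differentiable f) x)
  simpa [pd_apply] using h

/-- The action of polynomials on test functions as differential operators: `Xᵢ` acts as `∂ᵢ`. -/
def polyAction (n : ℕ) : MvPolynomial (Fin n) ℝ →ₐ[ℝ] Module.End ℝ (TestSpace n) :=
  -- `aeval` needs a commutative target: the subalgebra generated by the commuting `∂ᵢ`, rather than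
  -- all endomorphisms.
  haveI := Algebra.isMulCommutative_adjoin ℝ (s := Set.range (pd (n := n))) (by
    rintro _ ⟨i, rfl⟩ _ ⟨j, rfl⟩
    exact LinearMap.ext fun f => pd_comm i j f)
  open scoped IsMulCommutative in
  (Algebra.adjoin ℝ (Set.range (pd (n := n)))).val.comp
    (MvPolynomial.aeval fun i => ⟨pd i, Algebra.subset_adjoin ⟨i, rfl⟩⟩)

theorem polyAction_X (i : Fin n) : polyAction n (MvPolynomial.X i) = pd i := by
  simp [polyAction]

/-- With this structure, `I ^ ℓ • ⊤` for the irrelevant ideal `I` expresses being a finite sum of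
derivatives of order at least `ℓ` of test functions. -/
instance : Module (MvPolynomial (Fin n) ℝ) (TestSpace n) :=
  Module.compHom _ (polyAction n).toRingHom

theorem smul_def (p : MvPolynomial (Fin n) ℝ) (f : TestSpace n) : p • f = polyAction n p f := rfl

instance : IsScalarTower ℝ (MvPolynomial (Fin n) ℝ) (TestSpace n) :=
  ⟨fun c p f => by simp [smul_def]⟩

theorem X_smul (i : Fin n) (f : TestSpace n) :
    (MvPolynomial.X i : MvPolynomial (Fin n) ℝ) • f = pd i f := by
  rw [smul_def, polyAction_X]

/-! ### Iterated divergences and their polynomial dependence on the base point. -/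

/-- The operator `f ↦ ∑_{i₁,…,i_j} ∂_{i₁}⋯∂_{i_j} ((z-y)_{i₁}⋯(z-y)_{i_j} f)`. -/
def iteratedDiv (y : EuclideanSpace ℝ (Fin n)) : ℕ → TestSpace n →ₗ[ℝ] TestSpace n
  | 0 => LinearMap.id
  | j + 1 => ∑ i, pd i ∘ₗ iteratedDiv y j ∘ₗ coordMul y i

theorem iteratedDiv_succ (y : EuclideanSpace ℝ (Fin n)) (j : ℕ) (f : TestSpace n) :
    iteratedDiv y (j + 1) f = ∑ i, pd i (iteratedDiv y j (coordMul y i f)) := by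
  simp [iteratedDiv]

/-- Write `D_j` for the iterated divergence and `E = ∑ (z-y)ᵢ ∂ᵢ` for the Euler operator. The
commutation rule `E ∂ₖ = ∂ₖ E - ∂ₖ` turns `D_{j+1}` into `(n + j + E) D_j`, the recursion behind the
telescoping of the Taylor kernel. -/
theorem iteratedDiv_succ_eq (y : EuclideanSpace ℝ (Fin n)) (j : ℕ) (f : TestSpace n) :
    iteratedDiv y (j + 1) f = ((n : ℝ) + j) • iteratedDiv y j f +
      ∑ i, coordMul y i (pd i (iteratedDiv y j f)) := by
  induction j generalizing f with
  | zero =>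
    rw [iteratedDiv_succ]
    simp [iteratedDiv, pd_coordMul, Finset.sum_add_distrib, Nat.cast_smul_eq_nsmul]
  | succ j ih =>
    have key : ∀ (k : Fin n) (g : TestSpace n), ∑ i, coordMul y i (pd i (pd k g)) =
        pd k (∑ i, coordMul y i (pd i g)) - pd k g := by
      intro k g
      simp only [map_sum, pd_coordMul, Finset.sum_add_distrib, pd_comm k]
      simp
    rw [iteratedDiv_succ y (j + 1), iteratedDiv_succ y j f]
    simp_rw [ih]
    simp only [map_sum, map_add, map_smul]
    rw [Finset.sum_add_distrib, Finset.smul_sum]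
    rw [Finset.sum_comm (f := fun i k =>
      coordMul y i (pd i (pd k (iteratedDiv y j (coordMul y k f)))))]
    simp only [key, Finset.sum_sub_distrib, ← Finset.smul_sum, map_sum]
    push_cast
    module

theorem integral_iteratedDiv_succ (y : EuclideanSpace ℝ (Fin n)) (j : ℕ) (f : TestSpace n) :
    ∫ z, (iteratedDiv y (j + 1) f).1 z = 0 := by
  rw [iteratedDiv_succ]
  simp only [Submodule.coe_sum, Finset.sum_apply]
  rw [integral_finsetSum]
  · exact Finset.sum_eq_zero fun i _ => integral_pd i _
  · exact fun i _ => (TestSpace.continuous (pd i _)).integrable_of_hasCompactSupport (TestSpace.hasCompactSupport (pd i _))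

/-- Functions `y ↦ f(y)` with values in the test space that are polynomials of degree at most `d`
with coefficients in `U`. -/
def polyFamilies (d : ℕ) (U : Set (TestSpace n)) :
    Submodule ℝ (EuclideanSpace ℝ (Fin n) → TestSpace n) :=
  Submodule.span ℝ {g | ∃ β : Fin n → ℕ, ∑ i, β i ≤ d ∧ ∃ c ∈ U, g = fun y => (∏ i, y i ^ β i) • c}

theorem polyFamilies_mono {d e : ℕ} (h : d ≤ e) (U : Set (TestSpace n)) :
    polyFamilies d U ≤ polyFamilies e U :=
  Submodule.span_mono fun _ ⟨β, hβ, c, hc, hg⟩ => ⟨β, hβ.trans h, c, hc, hg⟩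

theorem polyFamilies_comp {d : ℕ} {U U' : Set (TestSpace n)} (T : TestSpace n →ₗ[ℝ] TestSpace n)
    (hT : ∀ f ∈ U, T f ∈ U') {g : EuclideanSpace ℝ (Fin n) → TestSpace n}
    (hg : g ∈ polyFamilies d U) : (fun y => T (g y)) ∈ polyFamilies d U' := by
  induction hg using Submodule.span_induction with
  | mem g h =>
    obtain ⟨β, hβ, c, hc, rfl⟩ := h
    exact Submodule.subset_span ⟨β, hβ, T c, hT c hc, by ext1 y; simp⟩
  | zero =>
    convert (polyFamilies d U').zero_mem using 1
    ext1 y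
    simp
  | add f g _ _ hf hg =>
    convert (polyFamilies d U').add_mem hf hg using 1
    ext1 y
    simp
  | smul c f _ hf =>
    convert (polyFamilies d U').smul_mem c hf using 1
    ext1 y
    simp

theorem polyFamilies_coord {d : ℕ} {U : Set (TestSpace n)} (i : Fin n)
    {g : EuclideanSpace ℝ (Fin n) → TestSpace n}
    (hg : g ∈ polyFamilies d U) : (fun y => y i • g y) ∈ polyFamilies (d + 1) U := by
  induction hg using Submodule.span_induction with
  | mem g h =>
    obtain ⟨β, hβ, c, hc, rfl⟩ := h
    refine Submodule.subset_span ⟨β + Pi.single i 1, ?_, c, hc, ?_⟩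
    · simp [Finset.sum_add_distrib, hβ]
    · ext1 y
      rw [smul_smul]
      congr 1
      simp only [Pi.add_apply, pow_add, Finset.prod_mul_distrib, Pi.single_apply]
      rw [mul_comm]
      congr 1
      simp [pow_ite]
  | zero =>
    convert (polyFamilies (d + 1) U).zero_mem using 1
    ext1 y
    simp
  | add f g _ _ hf hg =>
    convert (polyFamilies (d + 1) U).add_mem hf hg using 1
    ext1 y
    simp
  | smul c f _ hf =>
    convert (polyFamilies (d + 1) U).smul_mem c hf using 1
    ext1 y
    exact smul_comm (y i) c (f y)

/-- Splitting `zᵢ - yᵢ` into multiplication by `zᵢ`, which is independent of `y`, and the scalar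
`yᵢ` shows that only one degree in `y` is lost. -/
theorem polyFamilies_coordMul {d : ℕ} (i : Fin n)
    {g : EuclideanSpace ℝ (Fin n) → TestSpace n}
    (hg : g ∈ polyFamilies d Set.univ) :
    (fun y => coordMul y i (g y)) ∈ polyFamilies (d + 1) Set.univ := by
  have h : (fun y => coordMul y i (g y)) = (fun y => coordMul 0 i (g y)) - fun y => y i • g y := by
    ext y z
    simp [coordMul_apply, sub_mul]
  rw [h]
  exact Submodule.sub_mem _
    (polyFamilies_mono (Nat.le_succ d) _ (polyFamilies_comp _ (fun _ _ => Set.mem_univ _) hg))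
    (polyFamilies_coord i hg)

/-- Each factor `(z-y)ᵢ` costs one degree in `y`, and each outer `∂ᵢ` gains one power of the
irrelevant ideal. This holds for the coefficients themselves, so potentials can be chosen once for
finitely many test functions instead of separately for each `y`. -/
theorem iteratedDiv_mem_polyFamilies {d : ℕ} (j : ℕ)
    {g : EuclideanSpace ℝ (Fin n) → TestSpace n} (hg : g ∈ polyFamilies d Set.univ) :
    (fun y => iteratedDiv y j (g y)) ∈ polyFamilies (d + j)
      ((Ideal.span (Set.range (MvPolynomial.X : Fin n → MvPolynomial (Fin n) ℝ)) ^ j) •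
        (⊤ : Submodule (MvPolynomial (Fin n) ℝ) (TestSpace n)) :
        Submodule (MvPolynomial (Fin n) ℝ) (TestSpace n)) := by
  induction j generalizing d g with
  | zero => simpa [iteratedDiv] using hg
  | succ j ih =>
    have h : (fun y => iteratedDiv y (j + 1) (g y)) =
        ∑ i, fun y => pd i (iteratedDiv y j (coordMul y i (g y))) := by
      ext1 y
      rw [iteratedDiv_succ, Finset.sum_apply]
    rw [h]
    refine Submodule.sum_mem _ fun i _ => ?_
    refine polyFamilies_comp (pd i) ?_
      (polyFamilies_mono (by omega) _ (ih (polyFamilies_coordMul i hg)))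
    intro f hf
    rw [← X_smul, pow_succ', SetLike.mem_coe, Submodule.mul_smul]
    exact Submodule.smul_mem_smul (Ideal.subset_span ⟨i, rfl⟩) hf

theorem exists_eq_sum_of_mem_polyFamilies {d : ℕ} {U : Submodule ℝ (TestSpace n)}
    {g : EuclideanSpace ℝ (Fin n) → TestSpace n} (hg : g ∈ polyFamilies d (U : Set (TestSpace n))) :
    ∃ c : (Fin n → ℕ) → TestSpace n, (∀ β, c β ∈ U) ∧
      ∀ y, g y = ∑ β ∈ multiIndices n (d + 1), (∏ i, y i ^ β i) • c β := by
  classical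
  induction hg using Submodule.span_induction with
  | mem g h =>
    obtain ⟨β, hβ, c, hc, rfl⟩ := h
    refine ⟨Pi.single β c, fun γ => ?_, fun y => ?_⟩
    · rw [Pi.single_apply]
      split_ifs
      exacts [hc, U.zero_mem]
    · rw [Finset.sum_eq_single β]
      · simp
      · intro γ _ hγ
        simp [hγ]
      · intro h
        exact absurd (mem_multiIndices.2 (by omega)) h
  | zero => exact ⟨0, fun _ => U.zero_mem, by simp⟩
  | add f g _ _ hf hg =>
    obtain ⟨c, hc, hc'⟩ := hf
    obtain ⟨e, he, he'⟩ := hg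
    exact ⟨c + e, fun β => U.add_mem (hc β) (he β), fun y => by
      simp [hc', he', Finset.sum_add_distrib]⟩
  | smul a f _ hf =>
    obtain ⟨c, hc, hc'⟩ := hf
    refine ⟨a • c, fun β => U.smul_mem a (hc β), fun y => ?_⟩
    simp only [Pi.smul_apply, hc', Finset.smul_sum]
    exact Finset.sum_congr rfl fun β _ => smul_comm _ _ _

/-- The test functions with vanishing integral. -/
def meanZero (n : ℕ) : Submodule ℝ (TestSpace n) where
  carrier := {f | ∫ z, f.1 z = 0}
  zero_mem' := by simp
  add_mem' {f g} hf hg := by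
    have h : ∫ z, (f + g).1 z = (∫ z, f.1 z) + ∫ z, g.1 z := integral_add
      ((TestSpace.continuous f).integrable_of_hasCompactSupport (TestSpace.hasCompactSupport f))
      ((TestSpace.continuous g).integrable_of_hasCompactSupport (TestSpace.hasCompactSupport g))
    simp only [Set.mem_ofPred_eq] at hf hg ⊢
    rw [h, hf, hg, add_zero]
  smul_mem' c f hf := by
    have h : ∫ z, (c • f).1 z = c * ∫ z, f.1 z := integral_const_mul _ _
    simp only [Set.mem_ofPred_eq] at hf ⊢
    rw [h, hf, mul_zero]

theorem iteratedDiv_succ_mem_polyFamilies_meanZero {d : ℕ} (j : ℕ)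
    {g : EuclideanSpace ℝ (Fin n) → TestSpace n} (hg : g ∈ polyFamilies d Set.univ) :
    (fun y => iteratedDiv y (j + 1) (g y)) ∈ polyFamilies (d + (j + 1)) (meanZero n) := by
  have h : (fun y => iteratedDiv y (j + 1) (g y)) =
      ∑ i, fun y => pd i (iteratedDiv y j (coordMul y i (g y))) := by
    ext1 y
    rw [iteratedDiv_succ, Finset.sum_apply]
  rw [h]
  refine Submodule.sum_mem _ fun i _ => ?_
  exact polyFamilies_comp (pd i) (fun f _ => integral_pd i f)
      (polyFamilies_mono (by omega) _ (iteratedDiv_mem_polyFamilies j (polyFamilies_coordMul i hg)))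

theorem const_mem_polyFamilies (d : ℕ) (f : TestSpace n) :
    (fun _ => f) ∈ polyFamilies d (Set.univ : Set (TestSpace n)) :=
  Submodule.subset_span ⟨0, by simp, f, trivial, by simp⟩

/-! ### The Taylor kernel and its dilations. -/

/-- The kernel `K_y = ∑_{j ≤ L} (1/j!) ∑_{i₁,…,i_j} ∂_{i₁}⋯∂_{i_j} ((z-y)_{i₁}⋯(z-y)_{i_j} f)`
of the averaged Taylor polynomial of degree `L` at the point `y`. -/
def taylorKernel (f : TestSpace n) (L : ℕ) (y : EuclideanSpace ℝ (Fin n)) : TestSpace n :=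
  ∑ j ∈ Finset.range (L + 1), (j.factorial : ℝ)⁻¹ • iteratedDiv y j f

theorem taylorKernel_succ (f : TestSpace n) (L : ℕ) (y : EuclideanSpace ℝ (Fin n)) :
    taylorKernel f (L + 1) y =
      taylorKernel f L y + ((L + 1).factorial : ℝ)⁻¹ • iteratedDiv y (L + 1) f := by
  rw [taylorKernel, Finset.sum_range_succ]; rfl

theorem taylorKernel_zero (f : TestSpace n) (y : EuclideanSpace ℝ (Fin n)) :
    taylorKernel f 0 y = f := by
  simp [taylorKernel, iteratedDiv]

/-- All terms with `j ≥ 1` are divergences, so their coefficients have integral zero. The `j = 0`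
term is `f`, constant in `y`, and enters only the coefficient `β = 0`. -/
theorem exists_taylorKernel_eq_sum (f : TestSpace n) (L : ℕ) :
    ∃ c : (Fin n → ℕ) → TestSpace n, (∀ β, β ≠ 0 → ∫ z, (c β).1 z = 0) ∧
      ∀ y, taylorKernel f L y = ∑ β ∈ multiIndices n (L + 1), (∏ i, y i ^ β i) • c β := by
  classical
  have h : (fun y => taylorKernel f L y - f) ∈ polyFamilies L (meanZero n : Set (TestSpace n)) := by
    induction L with
    | zero =>
      simp only [taylorKernel_zero, sub_self]
      exact Submodule.zero_mem _
    | succ L ih =>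
      have h1 : (fun y => taylorKernel f (L + 1) y - f) = (fun y => taylorKernel f L y - f) +
          ((L + 1).factorial : ℝ)⁻¹ • fun y => iteratedDiv y (L + 1) f := by
        ext1 y
        simp only [taylorKernel_succ, Pi.add_apply, Pi.smul_apply]
        abel
      rw [h1]
      refine Submodule.add_mem _ (polyFamilies_mono (Nat.le_succ L) _ ih)
        (Submodule.smul_mem _ _ ?_)
      simpa using iteratedDiv_succ_mem_polyFamilies_meanZero L (const_mem_polyFamilies 0 f)
  obtain ⟨c, hc, hc'⟩ := exists_eq_sum_of_mem_polyFamilies h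
  refine ⟨c + Pi.single 0 f, fun β hβ => ?_, fun y => ?_⟩
  · have h1 : (c + Pi.single 0 f : (Fin n → ℕ) → TestSpace n) β = c β := by simp [hβ]
    rw [h1]
    exact hc β
  · have h0 : (0 : Fin n → ℕ) ∈ multiIndices n (L + 1) := mem_multiIndices.2 (by simp)
    have h2 : ∑ β ∈ multiIndices n (L + 1),
        (∏ i, y i ^ β i) • (Pi.single 0 f : (Fin n → ℕ) → TestSpace n) β = f := by
      rw [Finset.sum_eq_single_of_mem 0 h0]
      · simp
      · intro γ _ hγ
        simp [hγ]
    simp only [Pi.add_apply, smul_add, Finset.sum_add_distrib, h2, ← hc' y, sub_add_cancel]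

theorem integral_taylorKernel (f : TestSpace n) (L : ℕ) (y : EuclideanSpace ℝ (Fin n)) :
    ∫ z, (taylorKernel f L y).1 z = ∫ z, f.1 z := by
  induction L with
  | zero => rw [taylorKernel_zero]
  | succ L ih =>
    rw [taylorKernel_succ, ← ih]
    set k := taylorKernel f L y
    set g := iteratedDiv y (L + 1) f with hg
    have h : ∫ z, (k + ((L + 1).factorial : ℝ)⁻¹ • g).1 z =
        (∫ z, k.1 z) + ∫ z, (((L + 1).factorial : ℝ)⁻¹ • g).1 z := integral_add
      ((TestSpace.continuous _).integrable_of_hasCompactSupport (TestSpace.hasCompactSupport _))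
      ((TestSpace.continuous _).integrable_of_hasCompactSupport (TestSpace.hasCompactSupport _))
    have h' : ∫ z, (((L + 1).factorial : ℝ)⁻¹ • g).1 z = 0 :=
      (meanZero n).smul_mem _ (integral_iteratedDiv_succ y L f)
    rw [h, h', add_zero]

/-- By `iteratedDiv_succ_eq`, `(n + E) D_j / j! = D_{j+1} / j! - D_j / (j-1)!` for `j ≥ 1`, so the
sum over `j ≤ L` telescopes to its top term. -/
theorem smul_add_sum_coordMul_pd_taylorKernel (f : TestSpace n) (L : ℕ)
    (y : EuclideanSpace ℝ (Fin n)) :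
    (n : ℝ) • taylorKernel f L y + ∑ i, coordMul y i (pd i (taylorKernel f L y)) =
      (L.factorial : ℝ)⁻¹ • iteratedDiv y (L + 1) f := by
  induction L with
  | zero =>
    rw [taylorKernel_zero, iteratedDiv_succ_eq]
    simp [iteratedDiv]
  | succ L ih =>
    rw [taylorKernel_succ]
    have h := iteratedDiv_succ_eq y (L + 1) f
    set G := iteratedDiv y (L + 1) f
    simp only [map_add, map_smul, Finset.sum_add_distrib, ← Finset.smul_sum]
    have h1 : ∑ i, coordMul y i (pd i G) =
        iteratedDiv y (L + 1 + 1) f - ((n : ℝ) + (L + 1 : ℕ)) • G := by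
      rw [h]; abel
    rw [h1]
    have h2 : (n : ℝ) • (taylorKernel f L y + ((L + 1).factorial : ℝ)⁻¹ • G) +
        (∑ i, coordMul y i (pd i (taylorKernel f L y)) + ((L + 1).factorial : ℝ)⁻¹ •
          (iteratedDiv y (L + 1 + 1) f - ((n : ℝ) + (L + 1 : ℕ)) • G)) =
        ((n : ℝ) • taylorKernel f L y + ∑ i, coordMul y i (pd i (taylorKernel f L y))) +
          ((L + 1).factorial : ℝ)⁻¹ • iteratedDiv y (L + 1 + 1) f -
            (((L + 1).factorial : ℝ)⁻¹ * (L + 1 : ℕ)) • G := by module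
    rw [h2, ih]
    have h3 : ((L + 1).factorial : ℝ)⁻¹ * (L + 1 : ℕ) = (L.factorial : ℝ)⁻¹ := by
      rw [Nat.factorial_succ]
      push_cast
      field_simp
    rw [h3]
    abel

theorem hasDerivAt_dilation (f : TestSpace n) (y ζ : EuclideanSpace ℝ (Fin n)) {s : ℝ}
    (hs : s ≠ 0) :
    HasDerivAt (fun s => (s ^ n)⁻¹ * f.1 (y + s⁻¹ • (ζ - y)))
      (-(s ^ (n + 1))⁻¹ *
        ((n : ℝ) • f + ∑ i, coordMul y i (pd i f)).1 (y + s⁻¹ • (ζ - y))) s := by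
  have h1 : HasDerivAt (fun s : ℝ => y + s⁻¹ • (ζ - y)) ((-(s ^ 2)⁻¹) • (ζ - y)) s :=
    ((hasDerivAt_inv hs).smul_const _).const_add y
  have h2 := (TestSpace.differentiable f (y + s⁻¹ • (ζ - y))).hasFDerivAt.comp_hasDerivAt s h1
  have h3 : HasDerivAt (fun s : ℝ => (s ^ n)⁻¹) (-(n * (s ^ (n + 1))⁻¹)) s := by
    have := hasDerivAt_zpow (-(n : ℤ)) s (Or.inl hs)
    have h4 : (fun s : ℝ => (s ^ n)⁻¹) = fun s => s ^ (-(n : ℤ)) := by ext t; simp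
    rw [h4]
    refine this.congr_deriv ?_
    rw [show -(n : ℤ) - 1 = -((n + 1 : ℕ) : ℤ) by push_cast; ring, zpow_neg, zpow_natCast]
    push_cast
    ring
  refine (h3.mul h2).congr_deriv ?_
  have h4 : ((n : ℝ) • f + ∑ i, coordMul y i (pd i f)).1 (y + s⁻¹ • (ζ - y)) =
      n * f.1 (y + s⁻¹ • (ζ - y)) + fderiv ℝ f.1 (y + s⁻¹ • (ζ - y)) (s⁻¹ • (ζ - y)) := by
    have := sum_coordMul_pd_apply y f (y + s⁻¹ • (ζ - y))
    rw [add_sub_cancel_left] at this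
    rw [← this]
    rfl
  rw [h4]
  simp only [Function.comp_apply, map_smul, smul_eq_mul]
  field_simp
  ring

/-- The point of the weights `1/j!`: only derivatives of order `L + 1` survive in the
`s`-derivative, and these are the ones having potentials. -/
theorem hasDerivAt_taylorKernel_dilation (f : TestSpace n) (L : ℕ)
    (y ζ : EuclideanSpace ℝ (Fin n)) {s : ℝ} (hs : s ≠ 0) :
    HasDerivAt (fun s => (s ^ n)⁻¹ * (taylorKernel f L y).1 (y + s⁻¹ • (ζ - y)))
      (-(s ^ (n + 1))⁻¹ * ((L.factorial : ℝ)⁻¹ *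
        (iteratedDiv y (L + 1) f).1 (y + s⁻¹ • (ζ - y)))) s := by
  have h := hasDerivAt_dilation (taylorKernel f L y) y ζ hs
  rw [smul_add_sum_coordMul_pd_taylorKernel] at h
  exact h

/-- A normalized bump function in the test space. -/
def bump (n : ℕ) : TestSpace n :=
  let b : ContDiffBump (0 : EuclideanSpace ℝ (Fin n)) := ⟨1 / 4, 1 / 2, by norm_num, by norm_num⟩
  ⟨b.normed volume, b.contDiff_normed, fun z hz => by
    have h : z ∉ tsupport (b.normed volume) := by rwa [b.tsupport_normed_eq]
    exact image_eq_zero_of_notMem_tsupport h⟩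

theorem integral_bump (n : ℕ) : ∫ z, (bump n).1 z = 1 :=
  ContDiffBump.integral_normed _

end TestSpace

/-! ### Potentials: high derivatives lie in the range of the formal adjoint. -/

section Potential

variable {n : ℕ} {V W : Type*}
    [NormedAddCommGroup V] [InnerProductSpace ℝ V] [FiniteDimensional ℝ V]
    [NormedAddCommGroup W] [InnerProductSpace ℝ W] [FiniteDimensional ℝ W]

/-- The `W`-valued test function with given components in an orthonormal basis. -/
def vectorTest (φ : Fin (Module.finrank ℝ W) → TestSpace n) (z : EuclideanSpace ℝ (Fin n)) : W :=
  ∑ k, (φ k).1 z • stdOrthonormalBasis ℝ W k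

theorem contDiff_vectorTest (φ : Fin (Module.finrank ℝ W) → TestSpace n) :
    ContDiff ℝ ∞ (vectorTest φ : EuclideanSpace ℝ (Fin n) → W) :=
  ContDiff.sum fun k _ => (TestSpace.contDiff (φ k)).smul contDiff_const

theorem vectorTest_eq_zero (φ : Fin (Module.finrank ℝ W) → TestSpace n)
    {z : EuclideanSpace ℝ (Fin n)} (hz : 1 / 2 < ‖z‖) : (vectorTest φ z : W) = 0 :=
  Finset.sum_eq_zero fun k _ => by rw [TestSpace.eq_zero _ hz, zero_smul]

theorem adjointOp_vectorTest (B : Fin n → V →ₗ[ℝ] W)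
    (φ : Fin (Module.finrank ℝ W) → TestSpace n) (z : EuclideanSpace ℝ (Fin n)) :
    adjointOp B (vectorTest φ) z = -∑ i, ∑ k, (TestSpace.pd i (φ k)).1 z •
      LinearMap.adjoint (B i) (stdOrthonormalBasis ℝ W k) := by
  have h : HasFDerivAt (vectorTest φ : EuclideanSpace ℝ (Fin n) → W)
      (∑ k, (fderiv ℝ (φ k).1 z).smulRight (stdOrthonormalBasis ℝ W k)) z :=
    HasFDerivAt.fun_sum fun k _ =>
      (TestSpace.differentiable (φ k) z).hasFDerivAt.smul_const _
  simp only [adjointOp, h.fderiv]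
  simp [TestSpace.pd_apply, map_sum]

theorem adjointOp_vectorTest_add (B : Fin n → V →ₗ[ℝ] W)
    (φ ψ : Fin (Module.finrank ℝ W) → TestSpace n) (z : EuclideanSpace ℝ (Fin n)) :
    adjointOp B (vectorTest (φ + ψ)) z =
      adjointOp B (vectorTest φ) z + adjointOp B (vectorTest ψ) z := by
  simp [adjointOp_vectorTest, add_smul, Finset.sum_add_distrib]
  abel

theorem adjointOp_vectorTest_smul (B : Fin n → V →ₗ[ℝ] W) (c : ℝ)
    (φ : Fin (Module.finrank ℝ W) → TestSpace n) (z : EuclideanSpace ℝ (Fin n)) :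
    adjointOp B (vectorTest (c • φ)) z = c • adjointOp B (vectorTest φ) z := by
  simp [adjointOp_vectorTest, mul_smul, Finset.smul_sum]

theorem adjointOp_vectorTest_sum {α : Type*} (B : Fin n → V →ₗ[ℝ] W) (s : Finset α)
    (φ : α → Fin (Module.finrank ℝ W) → TestSpace n) (z : EuclideanSpace ℝ (Fin n)) :
    adjointOp B (vectorTest (∑ b ∈ s, φ b)) z = ∑ b ∈ s, adjointOp B (vectorTest (φ b)) z := by
  classical
  induction s using Finset.induction_on with
  | empty => simp [adjointOp_vectorTest]
  | insert b s hb ih => rw [Finset.sum_insert hb, Finset.sum_insert hb, adjointOp_vectorTest_add, ih]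

/-- For a `ℂ`-elliptic operator, derivatives of sufficiently high order of scalar test functions
lie in the range of the formal adjoint. -/
theorem IsCElliptic.exists_adjointOp_eq {B : Fin n → V →ₗ[ℝ] W} (hB : IsCElliptic B) :
    ∃ ℓ : ℕ, ∀ f ∈ ((Ideal.span (Set.range (MvPolynomial.X : Fin n → MvPolynomial (Fin n) ℝ)) ^ ℓ) •
        (⊤ : Submodule (MvPolynomial (Fin n) ℝ) (TestSpace n)) :
        Submodule (MvPolynomial (Fin n) ℝ) (TestSpace n)),
      ∀ a, ∃ φ : Fin (Module.finrank ℝ W) → TestSpace n,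
        ∀ z, adjointOp B (vectorTest φ) z = f.1 z • stdOrthonormalBasis ℝ V a := by
  classical
  set e := stdOrthonormalBasis ℝ V
  set w := stdOrthonormalBasis ℝ W
  obtain ⟨ℓ, hℓ⟩ := exists_pow_forall_vecMul_eq
    (fun i => LinearMap.toMatrix e.toBasis w.toBasis (B i))
    (hB.exists_leftInverse e.toBasis w.toBasis)
  refine ⟨ℓ, fun f hf a => ?_⟩
  induction hf using Submodule.smul_induction_on' with
  | add f _ g _ hf hg =>
    obtain ⟨φ, hφ⟩ := hf
    obtain ⟨ψ, hψ⟩ := hg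
    exact ⟨φ + ψ, fun z => by simp [adjointOp_vectorTest_add, hφ, hψ, add_smul]⟩
  | smul p hp g _ =>
    obtain ⟨q, hq⟩ := hℓ p hp a
    -- The sign cancels the one in the formal adjoint.
    refine ⟨fun k => -(q k • g), fun z => ?_⟩
    have hadj : ∀ i k, LinearMap.adjoint (B i) (w k) =
        ∑ b, LinearMap.toMatrix e.toBasis w.toBasis (B i) k b • e b := by
      intro i k
      rw [← e.sum_repr' (LinearMap.adjoint (B i) (w k))]
      refine Finset.sum_congr rfl fun b _ => ?_
      rw [LinearMap.adjoint_inner_right, LinearMap.toMatrix_apply]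
      simp [OrthonormalBasis.repr_apply_apply, real_inner_comm]
    rw [adjointOp_vectorTest]
    have h1 : ∀ i k, (TestSpace.pd i (-(q k • g))).1 z • LinearMap.adjoint (B i) (w k) =
        -∑ b, ((q k * (MvPolynomial.X i * MvPolynomial.C
          (LinearMap.toMatrix e.toBasis w.toBasis (B i) k b))) • g).1 z • e b := by
      intro i k
      rw [hadj, Finset.smul_sum, ← Finset.sum_neg_distrib]
      refine Finset.sum_congr rfl fun b _ => ?_
      have h2 : (q k * (MvPolynomial.X i * MvPolynomial.C
          (LinearMap.toMatrix e.toBasis w.toBasis (B i) k b))) • g =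
          (LinearMap.toMatrix e.toBasis w.toBasis (B i) k b) • TestSpace.pd i (q k • g) := by
        rw [← TestSpace.X_smul, smul_smul, ← smul_assoc, MvPolynomial.smul_eq_C_mul]
        congr 1
        ring
      rw [h2]
      simp [smul_smul, mul_comm]
    change -∑ i, ∑ k, (TestSpace.pd i (-(q k • g))).1 z • LinearMap.adjoint (B i) (w k) = _
    simp only [h1, Finset.sum_neg_distrib, neg_neg]
    calc ∑ i, ∑ k, ∑ b, ((q k * (MvPolynomial.X i * MvPolynomial.C
          (LinearMap.toMatrix e.toBasis w.toBasis (B i) k b))) • g).1 z • e b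
        = ∑ b, ((∑ k, q k * symbolMatrix (fun i => LinearMap.toMatrix e.toBasis w.toBasis (B i)) k b)
            • g).1 z • e b := by
          rw [Finset.sum_comm, Finset.sum_congr rfl fun k _ => Finset.sum_comm, Finset.sum_comm]
          refine Finset.sum_congr rfl fun b _ => ?_
          simp only [symbolMatrix_apply, Finset.mul_sum, Finset.sum_smul, Submodule.coe_sum,
            Finset.sum_apply]
      _ = (p • g).1 z • e a := by
          simp only [hq]
          rw [Finset.sum_eq_single a]
          · simp
          · intro b _ hb
            simp [Ne.symm hb]
          · simp

theorem exists_bound_vectorTest (φ : Fin (Module.finrank ℝ W) → TestSpace n) :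
    ∃ C, 0 ≤ C ∧ ∀ z, ‖(vectorTest φ z : W)‖ ≤ C := by
  choose C hC0 hC using fun k => TestSpace.exists_bound (φ k)
  refine ⟨∑ k, C k, Finset.sum_nonneg fun k _ => hC0 k, fun z => ?_⟩
  refine (norm_sum_le _ _).trans (Finset.sum_le_sum fun k _ => ?_)
  rw [norm_smul, (stdOrthonormalBasis ℝ W).norm_eq_one, mul_one]
  exact hC k z

theorem vectorTest_sum_smul {α : Type*} (s : Finset α) (c : α → ℝ)
    (φ : α → Fin (Module.finrank ℝ W) → TestSpace n) (z : EuclideanSpace ℝ (Fin n)) :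
    (vectorTest (∑ b ∈ s, c b • φ b) z : W) = ∑ b ∈ s, c b • vectorTest (φ b) z := by
  simp only [vectorTest, Finset.sum_apply, Finset.smul_sum, Submodule.coe_sum, Finset.sum_smul,
    Pi.smul_apply, Submodule.coe_smul, smul_smul, smul_eq_mul]
  exact Finset.sum_comm

theorem abs_prod_pow_le_one {y : EuclideanSpace ℝ (Fin n)} (hy : ‖y‖ ≤ 1) (β : Fin n → ℕ) :
    |∏ i, y i ^ β i| ≤ 1 := by
  rw [Finset.abs_prod]
  refine Finset.prod_le_one (fun i _ => abs_nonneg _) fun i _ => ?_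
  rw [abs_pow]
  exact pow_le_one₀ (abs_nonneg _) ((PiLp.norm_apply_le y i).trans hy)

/-- The top order term of the Taylor kernel has a potential which is bounded uniformly in the base
point. -/
theorem IsCElliptic.exists_potential {B : Fin n → V →ₗ[ℝ] W} (hB : IsCElliptic B)
    (f : TestSpace n) :
    ∃ (L : ℕ) (C : ℝ), 0 ≤ C ∧ ∀ y : EuclideanSpace ℝ (Fin n), ‖y‖ ≤ 1 → ∀ a,
      ∃ φ : Fin (Module.finrank ℝ W) → TestSpace n, (∀ z, ‖(vectorTest φ z : W)‖ ≤ C) ∧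
        ∀ z, adjointOp B (vectorTest φ) z =
          (TestSpace.iteratedDiv y (L + 1) f).1 z • stdOrthonormalBasis ℝ V a := by
  obtain ⟨L, hL⟩ := hB.exists_adjointOp_eq
  set U := ((Ideal.span (Set.range (MvPolynomial.X : Fin n → MvPolynomial (Fin n) ℝ)) ^ (L + 1)) •
        (⊤ : Submodule (MvPolynomial (Fin n) ℝ) (TestSpace n)) :
        Submodule (MvPolynomial (Fin n) ℝ) (TestSpace n)) with hU
  have hmem : (fun y => TestSpace.iteratedDiv y (L + 1) f) ∈
      TestSpace.polyFamilies (0 + (L + 1)) ((U.restrictScalars ℝ : Submodule ℝ (TestSpace n)) :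
        Set (TestSpace n)) :=
    TestSpace.iteratedDiv_mem_polyFamilies (L + 1) (TestSpace.const_mem_polyFamilies 0 f)
  obtain ⟨c, hc, hc'⟩ := TestSpace.exists_eq_sum_of_mem_polyFamilies hmem
  -- The Taylor degree `L` is the exponent from the algebra; the top term lies in the power `L + 1`,
  -- which is contained in the power `L`. The finitely many potentials chosen here do not depend on
  -- `y`.
  choose φ hφ using fun β => hL (c β) (Submodule.smul_mono_left (Ideal.pow_le_pow_right
    (Nat.le_succ L)) (hc β))
  choose C hC0 hC using fun β a => exists_bound_vectorTest (W := W) (φ β a)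
  refine ⟨L, ∑ β ∈ multiIndices n (0 + (L + 1) + 1), ∑ a, C β a,
    Finset.sum_nonneg fun β _ => Finset.sum_nonneg fun a _ => hC0 β a, fun y hy a => ?_⟩
  refine ⟨∑ β ∈ multiIndices n (0 + (L + 1) + 1), (∏ i, y i ^ β i) • φ β a, fun z => ?_,
    fun z => ?_⟩
  · rw [vectorTest_sum_smul]
    refine (norm_sum_le _ _).trans (Finset.sum_le_sum fun β _ => ?_)
    rw [norm_smul, Real.norm_eq_abs]
    calc _ ≤ 1 * C β a := mul_le_mul (abs_prod_pow_le_one hy β) (hC β a z) (norm_nonneg _) zero_le_one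
      _ ≤ ∑ a, C β a := by
        rw [one_mul]
        exact Finset.single_le_sum (fun a _ => hC0 β a) (Finset.mem_univ a)
  · rw [adjointOp_vectorTest_sum, hc' y]
    simp only [adjointOp_vectorTest_smul, hφ, Submodule.coe_sum, Finset.sum_apply,
      Finset.sum_smul, Submodule.coe_smul, Pi.smul_apply, smul_smul, smul_eq_mul]

end Potential

/-! ### Rescaling, and testing the distributional equation. -/

variable {n : ℕ}

/-- The affine map that sends `(1-s) y' + s B_r(x)` to the unit ball and fixes the position of `y'`
relative to the ball. -/
def blowUp (x : EuclideanSpace ℝ (Fin n)) (r : ℝ) (y' : EuclideanSpace ℝ (Fin n)) (s : ℝ)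
    (z : EuclideanSpace ℝ (Fin n)) : EuclideanSpace ℝ (Fin n) :=
  r⁻¹ • (y' - x) + (s⁻¹ * r⁻¹) • (z - y')

theorem blowUp_eq (x : EuclideanSpace ℝ (Fin n)) (r : ℝ) (y' : EuclideanSpace ℝ (Fin n)) (s : ℝ)
    (z : EuclideanSpace ℝ (Fin n)) :
    blowUp x r y' s z = r⁻¹ • (y' - x) + s⁻¹ • (r⁻¹ • (z - x) - r⁻¹ • (y' - x)) := by
  rw [blowUp, ← smul_sub, smul_smul, sub_sub_sub_cancel_right]

theorem blowUp_one (x : EuclideanSpace ℝ (Fin n)) (r : ℝ) (y' z : EuclideanSpace ℝ (Fin n)) :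
    blowUp x r y' 1 z = r⁻¹ • (z - x) := by
  rw [blowUp_eq]
  simp

theorem contDiff_blowUp (x : EuclideanSpace ℝ (Fin n)) (r : ℝ) (y' : EuclideanSpace ℝ (Fin n))
    (s : ℝ) : ContDiff ℝ ∞ (blowUp x r y' s) := by
  change ContDiff ℝ ∞ fun z => r⁻¹ • (y' - x) + (s⁻¹ * r⁻¹) • (z - y')
  fun_prop

theorem continuous_blowUp (x : EuclideanSpace ℝ (Fin n)) (r : ℝ) (y' : EuclideanSpace ℝ (Fin n))
    (s : ℝ) : Continuous (blowUp x r y' s) := (contDiff_blowUp x r y' s).continuous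

theorem norm_smul_sub_lt_one {x y' : EuclideanSpace ℝ (Fin n)} {r : ℝ} (hr : 0 < r)
    (hy : y' ∈ Metric.ball x r) : ‖r⁻¹ • (y' - x)‖ < 1 := by
  rw [norm_smul, Real.norm_of_nonneg (inv_nonneg.2 hr.le), inv_mul_lt_iff₀ hr, mul_one]
  rwa [mem_ball_iff_norm] at hy

/-- In unit-ball coordinates `z` is the convex combination `(1-s) y + s b` with `‖y‖ < 1` and `‖b‖ ≤
1/2`. Rescaled test functions therefore stay supported inside `B_r(x)` while shrinking to `y'`. -/
theorem mem_of_norm_blowUp_le {x y' z : EuclideanSpace ℝ (Fin n)} {r s : ℝ} (hr : 0 < r)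
    (hs : 0 < s) (hs1 : s ≤ 1) (hy : y' ∈ Metric.ball x r) (hz : ‖blowUp x r y' s z‖ ≤ 1 / 2) :
    z ∈ Metric.ball y' (2 * (r * s)) ∩ Metric.ball x r := by
  have hy1 := norm_smul_sub_lt_one hr hy
  set y := r⁻¹ • (y' - x) with hydef
  set b := blowUp x r y' s z with hb
  have h1 : z - y' = (r * s) • (b - y) := by
    rw [hb, blowUp, add_sub_cancel_left, smul_smul]
    rw [show r * s * (s⁻¹ * r⁻¹) = 1 by field_simp, one_smul]
  have h2 : y' - x = r • y := by rw [hydef, smul_smul, mul_inv_cancel₀ hr.ne', one_smul]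
  have h3 : z - x = r • ((1 - s) • y + s • b) := by
    rw [← sub_add_sub_cancel z y' x, h1, h2]
    module
  clear_value y b
  constructor
  · rw [mem_ball_iff_norm, h1, norm_smul, Real.norm_of_nonneg (by positivity), mul_comm 2]
    have : ‖b - y‖ < 2 := (norm_sub_le _ _).trans_lt (by linarith)
    gcongr
  · rw [mem_ball_iff_norm, h3, norm_smul, Real.norm_of_nonneg hr.le]
    have : ‖(1 - s) • y + s • b‖ < 1 := by
      refine (norm_add_le _ _).trans_lt ?_
      rw [norm_smul, norm_smul, Real.norm_of_nonneg (by linarith), Real.norm_of_nonneg hs.le]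
      nlinarith [norm_nonneg y]
    nlinarith

variable {V W : Type*}
    [NormedAddCommGroup V] [InnerProductSpace ℝ V] [FiniteDimensional ℝ V]
    [NormedAddCommGroup W] [InnerProductSpace ℝ W] [FiniteDimensional ℝ W]

theorem adjointOp_comp_blowUp (B : Fin n → V →ₗ[ℝ] W) {Ψ : EuclideanSpace ℝ (Fin n) → W}
    (hΨ : Differentiable ℝ Ψ) (x : EuclideanSpace ℝ (Fin n)) (r : ℝ)
    (y' : EuclideanSpace ℝ (Fin n)) (s : ℝ) (z : EuclideanSpace ℝ (Fin n)) :
    adjointOp B (fun z => Ψ (blowUp x r y' s z)) z =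
      (s⁻¹ * r⁻¹) • adjointOp B Ψ (blowUp x r y' s z) := by
  have h1 : HasFDerivAt (blowUp x r y' s)
      ((s⁻¹ * r⁻¹) • ContinuousLinearMap.id ℝ (EuclideanSpace ℝ (Fin n))) z :=
    ((((hasFDerivAt_id z).sub_const y').const_smul (s⁻¹ * r⁻¹)).const_add _)
  have h2 : HasFDerivAt (fun z => Ψ (blowUp x r y' s z)) _ z :=
    (hΨ (blowUp x r y' s z)).hasFDerivAt.comp z h1
  simp only [adjointOp, h2.fderiv]
  simp [Finset.smul_sum]

theorem norm_integral_innerSL_le {X : Type*} [MeasurableSpace X] (μ : VectorMeasure X W)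
    {S : Set X} (hS : MeasurableSet S) {Φ : X → W} {C : ℝ} (h0 : ∀ z, z ∉ S → Φ z = 0)
    (hC : ∀ z, ‖Φ z‖ ≤ C) : ‖μ.integral Φ (innerSL ℝ)‖ ≤ C * μ.variation.real S := by
  have := isFiniteMeasure_variation μ
  have h3 : ∫ z, ‖Φ z‖ ∂μ.variation ≤ C * μ.variation.real S := by
    calc ∫ z, ‖Φ z‖ ∂μ.variation ≤ ∫ z, S.indicator (fun _ => C) z ∂μ.variation := by
          refine integral_mono_of_nonneg (Eventually.of_forall fun z => norm_nonneg _)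
            ((integrable_const C).indicator hS) (Eventually.of_forall fun z => ?_)
          by_cases hz : z ∈ S
          · simpa [hz] using hC z
          · simp [hz, h0 z hz]
      _ = C * μ.variation.real S := by
          rw [integral_indicator_const _ hS, smul_eq_mul, mul_comm]
  refine VectorMeasure.norm_integral_le_integral_norm.trans ?_
  calc _ ≤ 1 * ∫ z, ‖Φ z‖ ∂μ.variation :=
        mul_le_mul_of_nonneg_right (norm_innerSL_le ℝ) (integral_nonneg fun _ => norm_nonneg _)
    _ ≤ _ := by rwa [one_mul]

/-- The distributional equation tested with a rescaled test function. -/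
theorem IsBVWithGradient.abs_integral_le {B : Fin n → V →ₗ[ℝ] W}
    {Ω : Set (EuclideanSpace ℝ (Fin n))} {u : EuclideanSpace ℝ (Fin n) → V}
    {μ : VectorMeasure (EuclideanSpace ℝ (Fin n)) W} (hu : IsBVWithGradient B Ω u μ)
    {x y' : EuclideanSpace ℝ (Fin n)} {r s C : ℝ} (hr : 0 < r) (hΩ : Metric.ball x r ⊆ Ω)
    (hs : 0 < s) (hs1 : s ≤ 1) (hy : y' ∈ Metric.ball x r)
    (φ : Fin (Module.finrank ℝ W) → TestSpace n) (hφ : ∀ z, ‖(vectorTest φ z : W)‖ ≤ C)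
    (g : EuclideanSpace ℝ (Fin n) → ℝ) (v : V)
    (hg : ∀ z, adjointOp B (vectorTest φ) z = g z • v) :
    |∫ z in Ω, g (blowUp x r y' s z) * inner ℝ v (u z)| ≤
      s * r * (C * μ.variation.real (Metric.ball y' (2 * (r * s)) ∩ Metric.ball x r)) := by
  set S := Metric.ball y' (2 * (r * s)) ∩ Metric.ball x r with hS
  have hSm : MeasurableSet S := Metric.isOpen_ball.measurableSet.inter Metric.isOpen_ball.measurableSet
  have hC : 0 ≤ C := (norm_nonneg _).trans (hφ 0)
  set Φ : EuclideanSpace ℝ (Fin n) → W := fun z => vectorTest φ (blowUp x r y' s z) with hΦ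
  have hΦs : ContDiff ℝ ∞ Φ := (contDiff_vectorTest φ).comp (contDiff_blowUp x r y' s)
  have hsupp : Function.support Φ ⊆ blowUp x r y' s ⁻¹' Metric.closedBall 0 (1 / 2) := by
    intro z hz
    by_contra h
    exact hz (vectorTest_eq_zero φ (by simpa using h))
  have hcl : IsClosed (blowUp x r y' s ⁻¹' Metric.closedBall 0 (1 / 2)) :=
    Metric.isClosed_closedBall.preimage (continuous_blowUp x r y' s)
  have hsub : blowUp x r y' s ⁻¹' Metric.closedBall 0 (1 / 2) ⊆ S := fun z hz =>
    mem_of_norm_blowUp_le hr hs hs1 hy (by simpa using hz)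
  have hts : tsupport Φ ⊆ blowUp x r y' s ⁻¹' Metric.closedBall 0 (1 / 2) :=
    closure_minimal hsupp hcl
  have hcs : HasCompactSupport Φ :=
    (isCompact_closedBall x r).of_isClosed_subset (isClosed_tsupport _)
      (hts.trans (hsub.trans (Set.inter_subset_right.trans Metric.ball_subset_closedBall)))
  have h := hu.integral_eq Φ hΦs hcs (hts.trans (hsub.trans (Set.inter_subset_right.trans hΩ)))
  have h1 : ∀ z, inner ℝ (adjointOp B Φ z) (u z) =
      (s⁻¹ * r⁻¹) * (g (blowUp x r y' s z) * inner ℝ v (u z)) := by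
    intro z
    rw [hΦ, adjointOp_comp_blowUp B ((contDiff_vectorTest φ).differentiable (by simp)), hg,
      smul_smul, inner_smul_left]
    simp [mul_assoc]
  simp only [h1] at h
  rw [integral_const_mul] at h
  -- Differentiating the rescaled potential produces `(s r)⁻¹`; moving it across gives the gain `s
  -- r`.
  have h2 : ∫ z in Ω, g (blowUp x r y' s z) * inner ℝ v (u z) =
      s * r * μ.integral Φ (innerSL ℝ) := by
    rw [h]
    field_simp
  rw [h2, abs_mul, abs_of_pos (mul_pos hs hr)]
  refine mul_le_mul_of_nonneg_left ?_ (by positivity)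
  rw [← Real.norm_eq_abs]
  refine norm_integral_innerSL_le μ hSm (fun z hz => ?_) (fun z => hφ _)
  by_contra h'
  exact hz (hsub (hsupp h'))

theorem norm_le_sum_abs_inner (v : V) : ‖v‖ ≤ ∑ a, |inner ℝ (stdOrthonormalBasis ℝ V a) v| := by
  conv_lhs => rw [← (stdOrthonormalBasis ℝ V).sum_repr' v]
  refine (norm_sum_le _ _).trans (Finset.sum_le_sum fun a _ => ?_)
  rw [norm_smul, (stdOrthonormalBasis ℝ V).norm_eq_one, mul_one, Real.norm_eq_abs]

omit [FiniteDimensional ℝ V] in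
theorem TestSpace.integrable_comp_smul (f : TestSpace n) {Ω : Set (EuclideanSpace ℝ (Fin n))}
    {u : EuclideanSpace ℝ (Fin n) → V} (hu : IntegrableOn u Ω)
    {T : EuclideanSpace ℝ (Fin n) → EuclideanSpace ℝ (Fin n)} (hT : Continuous T) :
    IntegrableOn (fun z => f.1 (T z) • u z) Ω := by
  obtain ⟨C, -, hC⟩ := TestSpace.exists_bound f
  exact hu.bdd_smul C ((TestSpace.continuous f).comp hT).aestronglyMeasurable
    (Eventually.of_forall fun z => hC (T z))

/-! ### Taylor averages across scales. -/

/-- The averages `∫ s⁻ⁿ K_y(y + (ζ - y)/s) u`, in the coordinates of the ball `B_r(x)`. -/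
def taylorAverage (f : TestSpace n) (L : ℕ) (Ω : Set (EuclideanSpace ℝ (Fin n)))
    (u : EuclideanSpace ℝ (Fin n) → V) (x : EuclideanSpace ℝ (Fin n)) (r : ℝ)
    (y' : EuclideanSpace ℝ (Fin n)) (s : ℝ) : V :=
  ∫ z in Ω, ((s ^ n)⁻¹ * (TestSpace.taylorKernel f L (r⁻¹ • (y' - x))).1 (blowUp x r y' s z)) • u z

omit [FiniteDimensional ℝ V] in
theorem hasDerivAt_taylorAverage (f : TestSpace n) (L : ℕ) {Ω : Set (EuclideanSpace ℝ (Fin n))}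
    {u : EuclideanSpace ℝ (Fin n) → V} (hu : IntegrableOn u Ω) (x : EuclideanSpace ℝ (Fin n)) (r : ℝ)
    (y' : EuclideanSpace ℝ (Fin n)) {s : ℝ} (hs : 0 < s) :
    HasDerivAt (taylorAverage f L Ω u x r y')
      (∫ z in Ω, (-(s ^ (n + 1))⁻¹ * ((L.factorial : ℝ)⁻¹ *
        (TestSpace.iteratedDiv (r⁻¹ • (y' - x)) (L + 1) f).1 (blowUp x r y' s z))) • u z) s := by
  obtain ⟨C, hC0, hC⟩ := TestSpace.exists_bound
    (TestSpace.iteratedDiv (r⁻¹ • (y' - x)) (L + 1) f)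
  refine (hasDerivAt_integral_of_dominated_loc_of_deriv_le (μ := volume.restrict Ω)
    (F := fun s z => ((s ^ n)⁻¹ *
      (TestSpace.taylorKernel f L (r⁻¹ • (y' - x))).1 (blowUp x r y' s z)) • u z)
    (F' := fun s z => (-(s ^ (n + 1))⁻¹ * ((L.factorial : ℝ)⁻¹ *
        (TestSpace.iteratedDiv (r⁻¹ • (y' - x)) (L + 1) f).1 (blowUp x r y' s z))) • u z)
    -- Staying above `s / 2` keeps the negative powers of the scale bounded.
    (s := Set.Ioi (s / 2)) (bound := fun z => (((s / 2) ^ (n + 1))⁻¹ * ((L.factorial : ℝ)⁻¹ * C)) * ‖u z‖)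
    (Ioi_mem_nhds (by linarith)) ?_ ?_ ?_ ?_ ?_ ?_).2
  · refine Eventually.of_forall fun t => ?_
    simp only [mul_smul]
    exact ((TestSpace.integrable_comp_smul _ hu (continuous_blowUp x r y' t)).smul
      ((t ^ n)⁻¹)).aestronglyMeasurable
  · simp only [mul_smul]
    exact (TestSpace.integrable_comp_smul _ hu (continuous_blowUp x r y' s)).smul ((s ^ n)⁻¹)
  · simp only [mul_smul]
    exact (((TestSpace.integrable_comp_smul _ hu (continuous_blowUp x r y' s)).smul
      (L.factorial : ℝ)⁻¹).smul (-(s ^ (n + 1))⁻¹)).aestronglyMeasurable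
  · refine Eventually.of_forall fun z t ht => ?_
    have ht' : s / 2 < t := ht
    have ht0 : 0 < t := by linarith
    rw [norm_smul]
    refine mul_le_mul_of_nonneg_right ?_ (norm_nonneg _)
    rw [Real.norm_eq_abs, abs_mul, abs_mul, abs_neg, abs_of_pos (by positivity : 0 < (t ^ (n + 1))⁻¹),
      abs_of_pos (by positivity : 0 < (L.factorial : ℝ)⁻¹)]
    gcongr
    exact hC _
  · exact hu.norm.const_mul _
  · refine Eventually.of_forall fun z t ht => ?_
    have ht' : s / 2 < t := ht
    have h := (TestSpace.hasDerivAt_taylorKernel_dilation f L (r⁻¹ • (y' - x)) (r⁻¹ • (z - x))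
      (by linarith : t ≠ 0)).smul_const (u z)
    simpa only [← blowUp_eq] using h

theorem volume_real_ball (x : EuclideanSpace ℝ (Fin n)) {r : ℝ} (hr : 0 < r) :
    volume.real (Metric.ball x r) =
      r ^ n * volume.real (Metric.ball (0 : EuclideanSpace ℝ (Fin n)) 1) := by
  rw [measureReal_def, Measure.addHaar_ball_of_pos volume x hr, ENNReal.toReal_mul,
    ENNReal.toReal_ofReal (by positivity), finrank_euclideanSpace_fin, measureReal_def]

theorem volume_real_ball_pos (x : EuclideanSpace ℝ (Fin n)) {r : ℝ} (hr : 0 < r) :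
    0 < volume.real (Metric.ball x r) :=
  ENNReal.toReal_pos (Metric.measure_ball_pos volume x hr).ne' measure_ball_lt_top.ne

/-- The differential operator `B` has potentials, bounded by `C`, for the top order terms of the
Taylor kernel of degree `L` of `f`. -/
def HasPotentials (B : Fin n → V →ₗ[ℝ] W) (f : TestSpace n) (L : ℕ) (C : ℝ) : Prop :=
  ∀ y : EuclideanSpace ℝ (Fin n), ‖y‖ ≤ 1 → ∀ a,
    ∃ φ : Fin (Module.finrank ℝ W) → TestSpace n, (∀ z, ‖(vectorTest φ z : W)‖ ≤ C) ∧
      ∀ z, adjointOp B (vectorTest φ) z =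
        (TestSpace.iteratedDiv y (L + 1) f).1 z • stdOrthonormalBasis ℝ V a

/-- Mean value inequality in the scale: the prefactor `s^(-n-1)` and the gain `s r` from the
potential bound each component of the derivative by `C r s^(-n)` times the variation. On `[σ/2, σ]`,
replacing `s` by `σ` costs `2 ^ n`. -/
theorem IsBVWithGradient.norm_taylorAverage_sub_le {B : Fin n → V →ₗ[ℝ] W} {f : TestSpace n} {L : ℕ}
    {C : ℝ} (hC : 0 ≤ C) (hB : HasPotentials B f L C)
    {Ω : Set (EuclideanSpace ℝ (Fin n))} {u : EuclideanSpace ℝ (Fin n) → V}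
    {μ : VectorMeasure (EuclideanSpace ℝ (Fin n)) W} (hu : IsBVWithGradient B Ω u μ)
    {x y' : EuclideanSpace ℝ (Fin n)} {r σ : ℝ} (hr : 0 < r) (hΩ : Metric.ball x r ⊆ Ω)
    (hσ : 0 < σ) (hσ1 : σ ≤ 1) (hy : y' ∈ Metric.ball x r) :
    ‖taylorAverage f L Ω u x r y' σ - taylorAverage f L Ω u x r y' (σ / 2)‖ ≤
      (Module.finrank ℝ V * C * 2 ^ n) * (r * σ * (σ ^ n)⁻¹) *
        μ.variation.real (Metric.ball y' (2 * (r * σ)) ∩ Metric.ball x r) := by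
  have := isFiniteMeasure_variation μ
  set m := μ.variation.real (Metric.ball y' (2 * (r * σ)) ∩ Metric.ball x r) with hm
  have hm0 : 0 ≤ m := measureReal_nonneg
  set D := Module.finrank ℝ V * (r * (2 ^ n * (σ ^ n)⁻¹) * (C * m)) with hD
  have hD0 : 0 ≤ D := by positivity
  have key := Convex.norm_image_sub_le_of_norm_hasDerivWithin_le (s := Set.Icc (σ / 2) σ)
    (f := taylorAverage f L Ω u x r y') (C := D) (x := σ / 2) (y := σ)
    (fun s hs => (hasDerivAt_taylorAverage f L hu.integrableOn x r y'
      (by linarith [hs.1] : 0 < s)).hasDerivWithinAt) ?_ (convex_Icc _ _)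
      ⟨le_rfl, by linarith⟩ ⟨by linarith, le_rfl⟩
  · refine key.trans ?_
    rw [Real.norm_of_nonneg (by linarith)]
    calc D * (σ - σ / 2) ≤ D * σ := by gcongr; linarith
      _ = _ := by rw [hD]; ring
  · intro s hs
    have hs0 : 0 < s := by linarith [hs.1]
    have hs1 : s ≤ 1 := hs.2.trans hσ1
    refine (norm_le_sum_abs_inner _).trans ?_
    have hterm : ∀ a, |inner ℝ (stdOrthonormalBasis ℝ V a) (∫ z in Ω, (-(s ^ (n + 1))⁻¹ *
        ((L.factorial : ℝ)⁻¹ * (TestSpace.iteratedDiv (r⁻¹ • (y' - x)) (L + 1) f).1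
          (blowUp x r y' s z))) • u z)| ≤ r * (2 ^ n * (σ ^ n)⁻¹) * (C * m) := by
      intro a
      obtain ⟨φ, hφ, hφ'⟩ := hB (r⁻¹ • (y' - x)) (norm_smul_sub_lt_one hr hy).le a
      have h1 := hu.abs_integral_le hr hΩ hs0 hs1 hy φ hφ _ _ hφ'
      have hint : Integrable (fun z => (-(s ^ (n + 1))⁻¹ *
        ((L.factorial : ℝ)⁻¹ * (TestSpace.iteratedDiv (r⁻¹ • (y' - x)) (L + 1) f).1
          (blowUp x r y' s z))) • u z) (volume.restrict Ω) := by
        simp only [mul_smul]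
        exact ((TestSpace.integrable_comp_smul _ hu.integrableOn (continuous_blowUp x r y' s)).smul
          (L.factorial : ℝ)⁻¹).smul (-(s ^ (n + 1))⁻¹)
      rw [← integral_inner hint]
      have h2 : ∀ z, inner ℝ (stdOrthonormalBasis ℝ V a) ((-(s ^ (n + 1))⁻¹ *
        ((L.factorial : ℝ)⁻¹ * (TestSpace.iteratedDiv (r⁻¹ • (y' - x)) (L + 1) f).1
          (blowUp x r y' s z))) • u z) = (-(s ^ (n + 1))⁻¹ * (L.factorial : ℝ)⁻¹) *
          ((TestSpace.iteratedDiv (r⁻¹ • (y' - x)) (L + 1) f).1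
          (blowUp x r y' s z) * inner ℝ (stdOrthonormalBasis ℝ V a) (u z)) := by
        intro z
        rw [inner_smul_right]
        ring
      simp only [h2]
      rw [integral_const_mul, abs_mul, abs_mul, abs_neg,
        abs_of_pos (by positivity : 0 < (s ^ (n + 1))⁻¹),
        abs_of_pos (by positivity : 0 < (L.factorial : ℝ)⁻¹)]
      have hL : (L.factorial : ℝ)⁻¹ ≤ 1 := inv_le_one_of_one_le₀ (by
        exact_mod_cast Nat.one_le_iff_ne_zero.2 L.factorial_ne_zero)
      have hmono : μ.variation.real (Metric.ball y' (2 * (r * s)) ∩ Metric.ball x r) ≤ m := by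
        refine measureReal_mono (Set.inter_subset_inter_left _ (Metric.ball_subset_ball ?_))
        have := hs.2
        gcongr
      have hpow : (s ^ n)⁻¹ ≤ 2 ^ n * (σ ^ n)⁻¹ := by
        have : (s ^ n)⁻¹ ≤ ((σ / 2) ^ n)⁻¹ := by
          gcongr
          exact hs.1
        refine this.trans_eq ?_
        rw [div_pow, inv_div, div_eq_mul_inv]
      calc _ ≤ (s ^ (n + 1))⁻¹ * 1 * (s * r * (C * m)) := by
            refine mul_le_mul (by gcongr) (h1.trans (by gcongr)) (abs_nonneg _) (by positivity)
        _ = r * (s ^ n)⁻¹ * (C * m) := by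
            rw [pow_succ]
            field_simp
        _ ≤ _ := by gcongr
    refine (Finset.sum_le_sum fun a _ => hterm a).trans_eq ?_
    simp [hD]

theorem integral_comp_blowUp (g : EuclideanSpace ℝ (Fin n) → ℝ) (x y' : EuclideanSpace ℝ (Fin n))
    {r s : ℝ} (hr : 0 < r) (hs : 0 < s) :
    ∫ z, g (blowUp x r y' s z) = (r * s) ^ n * ∫ z, g z := by
  have h1 : ∫ z, g (blowUp x r y' s z) =
      ∫ z, g (r⁻¹ • (y' - x) + (s⁻¹ * r⁻¹) • z) :=
    integral_sub_right_eq_self (fun z => g (r⁻¹ • (y' - x) + (s⁻¹ * r⁻¹) • z)) y'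
  rw [h1, Measure.integral_comp_smul volume (fun z => g (r⁻¹ • (y' - x) + z)),
    integral_add_left_eq_self, finrank_euclideanSpace_fin, smul_eq_mul,
    abs_of_pos (by positivity), ← inv_pow, mul_inv, inv_inv, inv_inv, mul_comm s r]

/-- The kernels have integral one and concentrate at `y'`, so they act as an approximate identity at
Lebesgue points. The exceptional null set is the same for all balls. -/
theorem ae_tendsto_taylorAverage (f : TestSpace n) (hf : ∫ z, f.1 z = 1) (L : ℕ)
    {Ω : Set (EuclideanSpace ℝ (Fin n))} (hΩo : IsOpen Ω)
    {u : EuclideanSpace ℝ (Fin n) → V} (hu : IntegrableOn u Ω) :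
    ∀ᵐ y', ∀ (x : EuclideanSpace ℝ (Fin n)) (r : ℝ), 0 < r → Metric.ball x r ⊆ Ω →
      y' ∈ Metric.ball x r →
      Tendsto (fun k : ℕ => (r ^ n)⁻¹ • taylorAverage f L Ω u x r y' ((1 / 2) ^ k))
        atTop (𝓝 (u y')) := by
  have hint : Integrable (Ω.indicator u) := hu.integrable_indicator hΩo.measurableSet
  filter_upwards [(Besicovitch.vitaliFamily volume).ae_tendsto_average_norm_sub
    hint.locallyIntegrable] with y' hy' x r hr hΩ hy
  have hδ0 : Tendsto (fun k : ℕ => 2 * (r * (1 / 2 : ℝ) ^ k)) atTop (𝓝 0) := by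
    have := ((tendsto_pow_atTop_nhds_zero_of_lt_one (r := (1 / 2 : ℝ)) (by norm_num)
      (by norm_num)).const_mul r).const_mul 2
    simpa using this
  have hδ : Tendsto (fun k : ℕ => 2 * (r * (1 / 2 : ℝ) ^ k)) atTop (𝓝[>] 0) :=
    tendsto_nhdsWithin_iff.2 ⟨hδ0, Eventually.of_forall fun k => by
      show (0 : ℝ) < _
      positivity⟩
  have havg := (hy'.comp (Besicovitch.tendsto_filterAt volume y')).comp hδ
  rw [Set.indicator_of_mem (hΩ hy)] at havg
  set K := TestSpace.taylorKernel f L (r⁻¹ • (y' - x)) with hK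
  obtain ⟨C, hC0, hC⟩ := TestSpace.exists_bound K
  have hs1 : ∀ k : ℕ, (1 / 2 : ℝ) ^ k ≤ 1 := fun k => pow_le_one₀ (by norm_num) (by norm_num)
  have hs0 : ∀ k : ℕ, 0 < (1 / 2 : ℝ) ^ k := fun k => by positivity
  have hsupp : ∀ k : ℕ, ∀ z, K.1 (blowUp x r y' ((1 / 2) ^ k) z) ≠ 0 →
      z ∈ Metric.ball y' (2 * (r * (1 / 2) ^ k)) ∩ Metric.ball x r := by
    intro k z hz
    refine mem_of_norm_blowUp_le hr (hs0 k) (hs1 k) hy ?_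
    by_contra h
    exact hz (TestSpace.eq_zero K (not_le.1 h))
  have hlim := tendsto_integral_smul_of_tendsto_average_norm_sub (μ := volume)
    (g := fun (k : ℕ) z => (r ^ n)⁻¹ * ((((1 / 2 : ℝ) ^ k) ^ n)⁻¹ *
      K.1 (blowUp x r y' ((1 / 2) ^ k) z)))
    -- The kernel at scale `s` is at most `C / (r s)^n`, and the ball containing its support has
    -- radius `2 r s`.
    (C * 2 ^ n * volume.real (Metric.ball (0 : EuclideanSpace ℝ (Fin n)) 1)) havg
    (Eventually.of_forall fun k => hint.integrableOn) ?_ ?_ ?_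
  · refine hlim.congr fun k => ?_
    rw [taylorAverage, ← integral_smul, ← integral_indicator hΩo.measurableSet]
    refine integral_congr_ae (Eventually.of_forall fun z => ?_)
    by_cases hz : z ∈ Ω
    · simp [hz, mul_smul, K]
    · simp [hz]
  · refine tendsto_const_nhds.congr fun k => ?_
    rw [integral_const_mul, integral_const_mul, integral_comp_blowUp _ _ _ hr (hs0 k), hK,
      TestSpace.integral_taylorKernel, hf, mul_pow]
    have := hs0 k
    field_simp
  · refine Eventually.of_forall fun k z hz => ?_
    refine Metric.ball_subset_closedBall (hsupp k z ?_).1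
    rw [Function.mem_support] at hz
    exact fun h => hz (by rw [h, mul_zero, mul_zero])
  · refine Eventually.of_forall fun k z => ?_
    have h0 := hs0 k
    have hv : 0 < volume.real (Metric.ball (0 : EuclideanSpace ℝ (Fin n)) 1) :=
      volume_real_ball_pos 0 one_pos
    beta_reduce
    rw [Measure.addHaar_real_closedBall volume _ (by positivity), finrank_euclideanSpace_fin,
      abs_mul, abs_mul, abs_of_pos (by positivity : 0 < (r ^ n)⁻¹),
      abs_of_pos (by positivity : 0 < (((1 / 2 : ℝ) ^ k) ^ n)⁻¹)]
    calc _ ≤ (r ^ n)⁻¹ * ((((1 / 2 : ℝ) ^ k) ^ n)⁻¹ * C) := by gcongr; exact hC _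
      _ = _ := by
        rw [mul_pow, mul_pow]
        field_simp

/-! ### Poincaré inequality on balls. -/

/-- Tonelli for the symmetric relation `dist z y < ρ`, with translation invariance of the volume. -/
theorem lintegral_measure_ball (ν : Measure (EuclideanSpace ℝ (Fin n))) [IsFiniteMeasure ν] (ρ : ℝ) :
    ∫⁻ y, ν (Metric.ball y ρ) = volume (Metric.ball (0 : EuclideanSpace ℝ (Fin n)) ρ) * ν Set.univ := by
  have hm : MeasurableSet {p : EuclideanSpace ℝ (Fin n) × EuclideanSpace ℝ (Fin n) |
      dist p.2 p.1 < ρ} :=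
    (isOpen_lt (by fun_prop) continuous_const).measurableSet
  have h1 := Measure.prod_apply (μ := (volume : Measure (EuclideanSpace ℝ (Fin n)))) (ν := ν) hm
  have h2 := Measure.prod_apply_symm (μ := (volume : Measure (EuclideanSpace ℝ (Fin n)))) (ν := ν) hm
  have h3 : ∫⁻ y, ν (Metric.ball y ρ) = ∫⁻ z, volume (Metric.ball z ρ) ∂ν := by
    refine (h1.symm.trans h2).trans (lintegral_congr fun z => ?_)
    congr 1
    ext y
    simp [dist_comm]
  rw [h3]
  simp [Measure.addHaar_ball_center]

/-- The Poincaré inequality on balls, with the averaged Taylor polynomial. -/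
theorem IsBVWithGradient.lintegral_enorm_sub_le {B : Fin n → V →ₗ[ℝ] W} {f : TestSpace n}
    (hf : ∫ z, f.1 z = 1) {L : ℕ} {C : ℝ} (hC : 0 ≤ C) (hB : HasPotentials B f L C)
    {Ω : Set (EuclideanSpace ℝ (Fin n))} (hΩo : IsOpen Ω) {u : EuclideanSpace ℝ (Fin n) → V}
    {μ : VectorMeasure (EuclideanSpace ℝ (Fin n)) W} (hu : IsBVWithGradient B Ω u μ)
    {x : EuclideanSpace ℝ (Fin n)} {r : ℝ} (hr : 0 < r) (hΩ : Metric.ball x r ⊆ Ω) :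
    ∫⁻ y' in Metric.ball x r, ‖u y' - (r ^ n)⁻¹ • taylorAverage f L Ω u x r y' 1‖ₑ ≤
      ENNReal.ofReal (Module.finrank ℝ V * C * 2 ^ n * 2 ^ n *
        volume.real (Metric.ball (0 : EuclideanSpace ℝ (Fin n)) 1) * 2 * r) *
        μ.variation (Metric.ball x r) := by
  have := isFiniteMeasure_variation μ
  set A : ℝ := Module.finrank ℝ V * C * 2 ^ n with hA
  have hA0 : 0 ≤ A := by positivity
  set ν := μ.variation.restrict (Metric.ball x r) with hν
  set σ : ℕ → ℝ := fun k => (1 / 2) ^ k with hσ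
  have hs1 : ∀ k : ℕ, σ k ≤ 1 := fun k => pow_le_one₀ (by norm_num) (by norm_num)
  have hs0 : ∀ k : ℕ, 0 < σ k := fun k => by positivity
  set D : ℕ → ℝ := fun k => (r ^ n)⁻¹ * (A * (r * σ k * (σ k ^ n)⁻¹)) with hD
  have hD0 : ∀ k, 0 ≤ D k := fun k => by have := hs0 k; positivity
  have hpt : ∀ᵐ y' ∂(volume.restrict (Metric.ball x r)),
      ‖u y' - (r ^ n)⁻¹ • taylorAverage f L Ω u x r y' 1‖ₑ ≤
        ∑' k, ENNReal.ofReal (D k) * ν (Metric.ball y' (2 * (r * σ k))) := by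
    rw [ae_restrict_iff' Metric.isOpen_ball.measurableSet]
    filter_upwards [ae_tendsto_taylorAverage f hf L hΩo hu.integrableOn] with y' hy' hy
    -- Telescoping from scale `1` down to the limit `u y'`.
    have h := edist_le_tsum_of_edist_le_of_tendsto₀
      (fun k => ENNReal.ofReal (D k) * ν (Metric.ball y' (2 * (r * σ k)))) (fun k => ?_)
      (hy' x r hr hΩ hy)
    · rw [pow_zero, edist_comm, edist_eq_enorm_sub] at h
      exact h
    · rw [edist_eq_enorm_sub, ← smul_sub, enorm_smul, pow_succ, ← div_eq_mul_one_div]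
      have h1 := hu.norm_taylorAverage_sub_le hC hB hr hΩ (hs0 k) (hs1 k) hy
      rw [← ofReal_norm, ← ofReal_norm, Real.norm_of_nonneg (by positivity), ← ENNReal.ofReal_mul (by positivity)]
      have h2 : ν (Metric.ball y' (2 * (r * σ k))) = ENNReal.ofReal
          (μ.variation.real (Metric.ball y' (2 * (r * σ k)) ∩ Metric.ball x r)) := by
        rw [ofReal_measureReal, hν, Measure.restrict_apply Metric.isOpen_ball.measurableSet]
      rw [h2, ← ENNReal.ofReal_mul (hD0 k)]
      refine ENNReal.ofReal_le_ofReal ?_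
      refine (mul_le_mul_of_nonneg_left h1 (by positivity)).trans_eq ?_
      simp only [hD]
      ring
  have hmeas : ∀ ρ, Measurable fun y' => ν (Metric.ball y' ρ) := by
    intro ρ
    have hm : MeasurableSet {p : EuclideanSpace ℝ (Fin n) × EuclideanSpace ℝ (Fin n) |
        dist p.2 p.1 < ρ} :=
      (isOpen_lt (by fun_prop) continuous_const).measurableSet
    exact measurable_measure_prodMk_left hm
  calc _ ≤ ∫⁻ y' in Metric.ball x r, ∑' k, ENNReal.ofReal (D k) *
          ν (Metric.ball y' (2 * (r * σ k))) := lintegral_mono_ae hpt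
    _ ≤ ∫⁻ y', ∑' k, ENNReal.ofReal (D k) * ν (Metric.ball y' (2 * (r * σ k))) :=
        setLIntegral_le_lintegral _ _
    _ = ∑' k, ENNReal.ofReal (A * 2 ^ n *
        volume.real (Metric.ball (0 : EuclideanSpace ℝ (Fin n)) 1) * r * σ k) *
          μ.variation (Metric.ball x r) := by
        rw [lintegral_tsum fun k => ((hmeas _).const_mul _).aemeasurable]
        refine tsum_congr fun k => ?_
        have h0 := hs0 k
        -- The volume of the ball of radius `2 r σ k` cancels `r^(-n) (σ k)^(-n)`; the factor `r σ
        -- k` that remains makes the series geometric.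
        rw [lintegral_const_mul _ (hmeas _), lintegral_measure_ball, ← mul_assoc]
        congr 1
        · rw [← ofReal_measureReal (μ := volume) (s := Metric.ball _ _) (h := measure_ball_lt_top.ne),
            volume_real_ball _ (by positivity), ← ENNReal.ofReal_mul (hD0 k)]
          congr 1
          simp only [hD, mul_pow]
          field_simp
        · rw [hν, Measure.restrict_apply_univ]
    _ = _ := by
        rw [ENNReal.tsum_mul_right]
        congr 1
        rw [← ENNReal.ofReal_tsum_of_nonneg]
        · rw [tsum_mul_left, tsum_geometric_two]
          congr 1
          ring
        · intro k
          have := hs0 k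
          positivity
        · exact summable_geometric_two.mul_left _

/-! ### Decay of the mean oscillation and of the Taylor coefficients. -/

/-- A nonnegative function that is contracted, up to a vanishing error, under a fixed dilation
tends to zero at the origin. -/
theorem tendsto_zero_of_dilation_le {e g : ℝ → ℝ} {θ r₀ : ℝ} (hθ0 : 0 < θ) (hθ1 : θ < 1)
    (hr₀ : 0 < r₀) (he : ∀ r, 0 ≤ e r) (hg : Tendsto g (𝓝[>] 0) (𝓝 0))
    (hstep : ∀ r, 0 < r → r < r₀ → e (θ * r) ≤ e r / 2 + g r)
    (hbdd : ∀ ρ, 0 < ρ → ρ < r₀ → ∃ M, ∀ r, θ * ρ ≤ r → r ≤ ρ → e r ≤ M) :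
    Tendsto e (𝓝[>] 0) (𝓝 0) := by
  rw [Metric.tendsto_nhds]
  intro ε hε
  have hgε : ∀ᶠ r in 𝓝[>] (0 : ℝ), g r < ε / 8 :=
    (tendsto_order.1 hg).2 _ (by positivity)
  obtain ⟨δ, hδ0, hδ⟩ := mem_nhdsGT_iff_exists_Ioo_subset.1 hgε
  have hδ0' : 0 < δ := hδ0
  obtain ⟨ρ, hρ0, hρ⟩ := exists_between (lt_min hδ0' hr₀)
  obtain ⟨M, hM⟩ := hbdd ρ hρ0 (hρ.trans_le (min_le_right _ _))
  have hM0 : 0 ≤ M := (he ρ).trans (hM ρ (by nlinarith) le_rfl)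
  -- The error `ε / 4` reproduces itself: half of it plus the new error `ε / 8` is `ε / 4` again.
  have hind : ∀ k : ℕ, ∀ r, θ ^ (k + 1) * ρ ≤ r → r ≤ θ ^ k * ρ →
      e r ≤ M * (1 / 2) ^ k + ε / 4 := by
    intro k
    induction k with
    | zero =>
      intro r h1 h2
      have := hM r (by simpa using h1) (by simpa using h2)
      simp only [pow_zero, mul_one]
      linarith
    | succ k ih =>
      intro r h1 h2
      have hr0 : 0 < r := lt_of_lt_of_le (by positivity) h1
      have h3 : r / θ ≤ θ ^ k * ρ := by
        rw [div_le_iff₀ hθ0]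
        calc r ≤ θ ^ (k + 1) * ρ := h2
          _ = _ := by ring
      have h4 : θ ^ (k + 1) * ρ ≤ r / θ := by
        rw [le_div_iff₀ hθ0]
        calc _ = θ ^ (k + 1 + 1) * ρ := by ring
          _ ≤ r := h1
      have h5 : r / θ ≤ ρ := h3.trans (mul_le_of_le_one_left hρ0.le (pow_le_one₀ hθ0.le hθ1.le))
      have h6 : r / θ < min δ r₀ := h5.trans_lt hρ
      have h7 := hstep (r / θ) (by positivity) (h6.trans_le (min_le_right _ _))
      have h8 : g (r / θ) < ε / 8 := hδ ⟨by positivity, h6.trans_le (min_le_left _ _)⟩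
      rw [mul_div_cancel₀ _ hθ0.ne'] at h7
      have h9 := ih _ h4 h3
      rw [pow_succ]
      linarith
  obtain ⟨K, hK⟩ : ∃ K : ℕ, M * (1 / 2) ^ K < ε / 4 := by
    have := (tendsto_pow_atTop_nhds_zero_of_lt_one (r := (1 / 2 : ℝ)) (by norm_num)
      (by norm_num)).const_mul M
    rw [mul_zero] at this
    exact ((tendsto_order.1 this).2 _ (by positivity)).exists
  have hev : ∀ᶠ r in 𝓝[>] (0 : ℝ), r ∈ Set.Ioo 0 (θ ^ K * ρ) :=
    Ioo_mem_nhdsGT (by positivity)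
  filter_upwards [hev] with r hr
  have hrρ : r / ρ < θ ^ K := (div_lt_iff₀ hρ0).2 hr.2
  obtain ⟨k, hk1, hk2⟩ := exists_nat_pow_near_of_lt_one (div_pos hr.1 hρ0)
    (hrρ.le.trans (pow_le_one₀ hθ0.le hθ1.le)) hθ0 hθ1
  have hKk : K ≤ k := by
    have := (pow_lt_pow_iff_right_of_lt_one₀ hθ0 hθ1).1 (hk1.trans hrρ)
    omega
  have h := hind k r ((lt_div_iff₀ hρ0).1 hk1).le ((div_le_iff₀ hρ0).1 hk2)
  have h' : M * (1 / 2) ^ k ≤ M * (1 / 2) ^ K :=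
    mul_le_mul_of_nonneg_left (pow_le_pow_of_le_one (by norm_num) (by norm_num) hKk) hM0
  rw [Real.dist_eq, sub_zero, abs_of_nonneg (he r)]
  linarith

omit [FiniteDimensional ℝ V] in
theorem continuous_centredPolynomial (ℓ : ℕ) (x : EuclideanSpace ℝ (Fin n))
    (a : (Fin n → ℕ) → V) : Continuous (centredPolynomial ℓ x a) := by
  unfold centredPolynomial
  fun_prop

/-- The coefficients of the averaged Taylor polynomial whose kernel has coefficients `c`. -/
def taylorCoeff (c : (Fin n → ℕ) → TestSpace n) (Ω : Set (EuclideanSpace ℝ (Fin n)))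
    (u : EuclideanSpace ℝ (Fin n) → V) (x : EuclideanSpace ℝ (Fin n)) (r : ℝ) (β : Fin n → ℕ) : V :=
  (r ^ (∑ i, β i))⁻¹ • (r ^ n)⁻¹ • ∫ z in Ω, (c β).1 (r⁻¹ • (z - x)) • u z

omit [FiniteDimensional ℝ V] in
-- At `s = 1` the blow-up no longer involves `y'`, which then enters only through the polynomial
-- dependence of the kernel on its base point.
theorem taylorAverage_one_eq {f : TestSpace n} {L : ℕ} {c : (Fin n → ℕ) → TestSpace n}
    (hc : ∀ y, TestSpace.taylorKernel f L y =
      ∑ β ∈ multiIndices n (L + 1), (∏ i, y i ^ β i) • c β)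
    {Ω : Set (EuclideanSpace ℝ (Fin n))} {u : EuclideanSpace ℝ (Fin n) → V}
    (hu : IntegrableOn u Ω) (x y' : EuclideanSpace ℝ (Fin n)) (r : ℝ) :
    (r ^ n)⁻¹ • taylorAverage f L Ω u x r y' 1 =
      centredPolynomial (L + 1) x (taylorCoeff c Ω u x r) y' := by
  have hT : Continuous fun z : EuclideanSpace ℝ (Fin n) => r⁻¹ • (z - x) := by fun_prop
  rw [taylorAverage, centredPolynomial]
  have h1 : ∀ z, ((1 ^ n : ℝ)⁻¹ * (TestSpace.taylorKernel f L (r⁻¹ • (y' - x))).1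
      (blowUp x r y' 1 z)) • u z = ∑ β ∈ multiIndices n (L + 1),
        (∏ i, (r⁻¹ • (y' - x)) i ^ β i) • (c β).1 (r⁻¹ • (z - x)) • u z := by
    intro z
    rw [hc, blowUp_one]
    simp only [one_pow, inv_one, one_mul, Submodule.coe_sum, Finset.sum_apply, Submodule.coe_smul,
      Pi.smul_apply, Finset.sum_smul, smul_assoc]
  simp only [h1]
  rw [integral_finsetSum (multiIndices n (L + 1)) (f := fun β z =>
      (∏ i, (r⁻¹ • (y' - x)) i ^ β i) • (c β).1 (r⁻¹ • (z - x)) • u z)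
      (fun β _ => (TestSpace.integrable_comp_smul (c β) hu hT).smul _), Finset.smul_sum]
  refine Finset.sum_congr rfl fun β _ => ?_
  have h2 : ∏ i, (r⁻¹ • (y' - x)) i ^ β i =
      (r ^ (∑ i, β i))⁻¹ * ∏ i, (y' i - x i) ^ β i := by
    simp only [PiLp.smul_apply, PiLp.sub_apply, smul_eq_mul, mul_pow, Finset.prod_mul_distrib]
    rw [Finset.prod_pow_eq_pow_sum, inv_pow]
  rw [integral_smul, taylorCoeff, h2]
  simp only [smul_smul]
  congr 1
  ring

omit [InnerProductSpace ℝ V] [FiniteDimensional ℝ V] in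
theorem integrableOn_ball_sub {Ω : Set (EuclideanSpace ℝ (Fin n))}
    {u : EuclideanSpace ℝ (Fin n) → V} (hu : IntegrableOn u Ω) {x : EuclideanSpace ℝ (Fin n)} {r : ℝ}
    (hΩ : Metric.ball x r ⊆ Ω) {p : EuclideanSpace ℝ (Fin n) → V} (hp : Continuous p) :
    IntegrableOn (fun y => u y - p y) (Metric.ball x r) :=
  (hu.mono_set hΩ).sub ((hp.continuousOn.integrableOn_compact (isCompact_closedBall x r)).mono_set
    Metric.ball_subset_closedBall)

/-- The mean oscillation `inf_z ⨍_{B_r(x)} |u - z|`. -/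
def meanOsc (u : EuclideanSpace ℝ (Fin n) → V) (x : EuclideanSpace ℝ (Fin n)) (r : ℝ) : ℝ :=
  ⨅ z : V, ⨍ y in Metric.ball x r, ‖u y - z‖

omit [InnerProductSpace ℝ V] [FiniteDimensional ℝ V] in
theorem average_norm_nonneg (u : EuclideanSpace ℝ (Fin n) → V) (s : Set (EuclideanSpace ℝ (Fin n))) :
    0 ≤ ⨍ y in s, ‖u y‖ := by
  rw [setAverage_eq]
  exact smul_nonneg (by positivity) (integral_nonneg fun _ => norm_nonneg _)

omit [InnerProductSpace ℝ V] [FiniteDimensional ℝ V] in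
theorem meanOsc_nonneg (u : EuclideanSpace ℝ (Fin n) → V) (x : EuclideanSpace ℝ (Fin n)) (r : ℝ) :
    0 ≤ meanOsc u x r :=
  Real.iInf_nonneg fun z => average_norm_nonneg (fun y => u y - z) _

omit [InnerProductSpace ℝ V] [FiniteDimensional ℝ V] in
theorem meanOsc_le (u : EuclideanSpace ℝ (Fin n) → V) (x : EuclideanSpace ℝ (Fin n)) (r : ℝ) (z : V) :
    meanOsc u x r ≤ ⨍ y in Metric.ball x r, ‖u y - z‖ :=
  ciInf_le ⟨0, by rintro _ ⟨z, rfl⟩; exact average_norm_nonneg (fun y => u y - z) _⟩ z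

/-- Since `c β` has integral zero, any constant may be subtracted from `u` before estimating; the
infimum over constants is the mean oscillation. -/
theorem norm_smul_taylorCoeff_le {c : (Fin n → ℕ) → TestSpace n} {β : Fin n → ℕ}
    (hβ : ∫ z, (c β).1 z = 0) {M : ℝ} (hM : ∀ z, |(c β).1 z| ≤ M)
    {Ω : Set (EuclideanSpace ℝ (Fin n))} (hΩo : IsOpen Ω) {u : EuclideanSpace ℝ (Fin n) → V}
    (hu : IntegrableOn u Ω)
    {x : EuclideanSpace ℝ (Fin n)} {r : ℝ} (hr : 0 < r) (hΩ : Metric.ball x r ⊆ Ω) :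
    ‖r ^ (∑ i, β i) • taylorCoeff c Ω u x r β‖ ≤
      M * volume.real (Metric.ball (0 : EuclideanSpace ℝ (Fin n)) 1) * meanOsc u x r := by
  have hM0 : 0 ≤ M := (abs_nonneg _).trans (hM 0)
  rw [meanOsc, Real.mul_iInf_of_nonneg (mul_nonneg hM0 measureReal_nonneg)]
  refine le_ciInf fun v => ?_
  have hT : Continuous fun z : EuclideanSpace ℝ (Fin n) => r⁻¹ • (z - x) := by fun_prop
  have hsupp : ∀ z, z ∉ Metric.ball x r → (c β).1 (r⁻¹ • (z - x)) = 0 := by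
    intro z hz
    refine TestSpace.eq_zero _ ?_
    rw [mem_ball_iff_norm, not_lt] at hz
    rw [norm_smul, Real.norm_of_nonneg (by positivity), ← div_eq_inv_mul, lt_div_iff₀ hr]
    linarith
  have hball : MeasurableSet (Metric.ball x r) := Metric.isOpen_ball.measurableSet
  have h1 : ∫ z in Ω, (c β).1 (r⁻¹ • (z - x)) • u z =
      ∫ z in Metric.ball x r, (c β).1 (r⁻¹ • (z - x)) • u z := by
    refine (setIntegral_eq_of_subset_of_forall_sdiff_eq_zero hΩo.measurableSet hΩ ?_)
    intro z hz
    rw [hsupp z hz.2, zero_smul]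
  have h2 : ∫ z in Metric.ball x r, (c β).1 (r⁻¹ • (z - x)) = 0 := by
    rw [setIntegral_eq_integral_of_forall_compl_eq_zero hsupp]
    have := integral_comp_blowUp (c β).1 x x hr one_pos
    simp only [blowUp_one] at this
    rw [this, hβ, mul_zero]
  have hc1 : IntegrableOn (fun z => (c β).1 (r⁻¹ • (z - x))) (Metric.ball x r) :=
    (((TestSpace.continuous (c β)).comp hT).continuousOn.integrableOn_compact
      (isCompact_closedBall x r)).mono_set Metric.ball_subset_closedBall
  have h3 : ∫ z in Metric.ball x r, (c β).1 (r⁻¹ • (z - x)) • u z =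
      ∫ z in Metric.ball x r, (c β).1 (r⁻¹ • (z - x)) • (u z - v) := by
    have hs : ∀ z, (c β).1 (r⁻¹ • (z - x)) • (u z - v) =
        (c β).1 (r⁻¹ • (z - x)) • u z - (c β).1 (r⁻¹ • (z - x)) • v := fun z => smul_sub _ _ _
    simp only [hs]
    rw [integral_sub (TestSpace.integrable_comp_smul (c β) (hu.mono_set hΩ) hT) (hc1.smul_const v),
      integral_smul_const, h2, zero_smul, sub_zero]
  have h4 : ‖∫ z in Metric.ball x r, (c β).1 (r⁻¹ • (z - x)) • (u z - v)‖ ≤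
      M * ∫ z in Metric.ball x r, ‖u z - v‖ := by
    rw [← integral_const_mul]
    refine norm_integral_le_of_norm_le
      ((integrableOn_ball_sub hu hΩ continuous_const).norm.const_mul M) (Eventually.of_forall fun z => ?_)
    rw [norm_smul]
    exact mul_le_mul_of_nonneg_right (hM _) (norm_nonneg _)
  have hv := volume_real_ball_pos (n := n) 0 one_pos
  rw [taylorCoeff, smul_smul, mul_inv_cancel₀ (by positivity), one_smul, h1, h3, norm_smul,
    Real.norm_of_nonneg (by positivity), setAverage_eq, volume_real_ball x hr, smul_eq_mul]
  calc _ ≤ (r ^ n)⁻¹ * (M * ∫ z in Metric.ball x r, ‖u z - v‖) := by gcongr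
    _ = _ := by field_simp

omit [FiniteDimensional ℝ V] in
-- Every nonconstant monomial has degree at least one, so on the smaller ball it gains at least one
-- factor `θ`.
theorem norm_centredPolynomial_sub_le {L : ℕ} (x : EuclideanSpace ℝ (Fin n)) {a : (Fin n → ℕ) → V}
    {r θ E : ℝ} (hr : 0 < r) (hθ0 : 0 < θ) (hθ1 : θ ≤ 1) (hE : 0 ≤ E)
    (ha : ∀ β ∈ multiIndices n (L + 1), β ≠ 0 → ‖r ^ (∑ i, β i) • a β‖ ≤ E)
    {y : EuclideanSpace ℝ (Fin n)} (hy : y ∈ Metric.ball x (θ * r)) :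
    ‖centredPolynomial (L + 1) x a y - a 0‖ ≤ (multiIndices n (L + 1)).card * (θ * E) := by
  classical
  have h0 : (0 : Fin n → ℕ) ∈ multiIndices n (L + 1) := mem_multiIndices.2 (by simp)
  have h1 : centredPolynomial (L + 1) x a y - a 0 =
      ∑ β ∈ (multiIndices n (L + 1)).erase 0, (∏ i, (y i - x i) ^ β i) • a β := by
    rw [centredPolynomial, ← Finset.add_sum_erase _ _ h0]
    simp
  rw [h1]
  refine (norm_sum_le _ _).trans ?_
  have h2 : ∀ β ∈ (multiIndices n (L + 1)).erase 0, ‖(∏ i, (y i - x i) ^ β i) • a β‖ ≤ θ * E := by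
    intro β hβ
    obtain ⟨hβ0, hβm⟩ := Finset.mem_erase.1 hβ
    have hpos : ∑ i, β i ≠ 0 := fun h => hβ0 (funext fun i => by
      simpa using (Finset.sum_eq_zero_iff.1 h) i (Finset.mem_univ i))
    have h3 : ‖∏ i, (y i - x i) ^ β i‖ ≤ (θ * r) ^ (∑ i, β i) := by
      rw [← Finset.prod_pow_eq_pow_sum, norm_prod]
      refine Finset.prod_le_prod (fun i _ => norm_nonneg _) fun i _ => ?_
      rw [norm_pow]
      refine pow_le_pow_left₀ (norm_nonneg _) ?_ _
      rw [mem_ball_iff_norm] at hy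
      exact (PiLp.norm_apply_le (y - x) i).trans hy.le
    rw [norm_smul]
    have h4 := ha β hβm hβ0
    rw [norm_smul, Real.norm_of_nonneg (by positivity)] at h4
    calc _ ≤ (θ * r) ^ (∑ i, β i) * ‖a β‖ := by gcongr
      _ = θ ^ (∑ i, β i) * (r ^ (∑ i, β i) * ‖a β‖) := by rw [mul_pow]; ring
      _ ≤ θ * E := by
        gcongr
        exact pow_le_of_le_one hθ0.le hθ1 hpos
  refine (Finset.sum_le_sum h2).trans ?_
  rw [Finset.sum_const, nsmul_eq_mul]
  gcongr
  exact Finset.erase_subset _ _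

omit [FiniteDimensional ℝ V] in
/-- Comparison of the mean oscillations on concentric balls. -/
theorem meanOsc_le_of_centredPolynomial {L : ℕ} {Ω : Set (EuclideanSpace ℝ (Fin n))}
    {u : EuclideanSpace ℝ (Fin n) → V} (hu : IntegrableOn u Ω)
    {x : EuclideanSpace ℝ (Fin n)} {a : (Fin n → ℕ) → V} {r θ E : ℝ} (hr : 0 < r)
    (hΩ : Metric.ball x r ⊆ Ω) (hθ0 : 0 < θ) (hθ1 : θ ≤ 1) (hE : 0 ≤ E)
    (ha : ∀ β ∈ multiIndices n (L + 1), β ≠ 0 → ‖r ^ (∑ i, β i) • a β‖ ≤ E) :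
    meanOsc u x (θ * r) ≤ (θ ^ n)⁻¹ *
      (⨍ y in Metric.ball x r, ‖u y - centredPolynomial (L + 1) x a y‖) +
        (multiIndices n (L + 1)).card * (θ * E) := by
  -- The constant term of the polynomial serves as competitor in the infimum.
  refine (meanOsc_le u x (θ * r) (a 0)).trans ?_
  set p := centredPolynomial (L + 1) x a with hp
  have hpc : Continuous p := continuous_centredPolynomial _ _ _
  have hsub : Metric.ball x (θ * r) ⊆ Metric.ball x r :=
    Metric.ball_subset_ball (mul_le_of_le_one_left hr.le hθ1)
  have hθr : 0 < θ * r := mul_pos hθ0 hr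
  have hI := integrableOn_ball_sub hu hΩ hpc
  have hv := volume_real_ball_pos (n := n) 0 one_pos
  have hv' := volume_real_ball_pos x hθr
  set D := ((multiIndices n (L + 1)).card : ℝ) * (θ * E) with hD
  have h1 : ∫ y in Metric.ball x (θ * r), ‖u y - a 0‖ ≤
      (∫ y in Metric.ball x r, ‖u y - p y‖) + volume.real (Metric.ball x (θ * r)) * D := by
    have hconst : IntegrableOn (fun _ : EuclideanSpace ℝ (Fin n) => D) (Metric.ball x (θ * r)) :=
      integrableOn_const measure_ball_lt_top.ne
    calc ∫ y in Metric.ball x (θ * r), ‖u y - a 0‖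
        ≤ ∫ y in Metric.ball x (θ * r), (‖u y - p y‖ + D) := by
          refine setIntegral_mono_on
            (integrableOn_ball_sub hu (hsub.trans hΩ) continuous_const).norm
            ((hI.mono_set hsub).norm.add hconst) Metric.isOpen_ball.measurableSet fun y hy => ?_
          calc ‖u y - a 0‖ ≤ ‖u y - p y‖ + ‖p y - a 0‖ := norm_sub_le_norm_sub_add_norm_sub _ _ _
            _ ≤ _ := by
              gcongr
              exact norm_centredPolynomial_sub_le x hr hθ0 hθ1 hE ha hy
      _ = (∫ y in Metric.ball x (θ * r), ‖u y - p y‖) + volume.real (Metric.ball x (θ * r)) * D := by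
          rw [integral_add (hI.mono_set hsub).norm hconst, setIntegral_const, smul_eq_mul]
      _ ≤ _ := by
          gcongr
          · exact Eventually.of_forall fun _ => norm_nonneg _
          · exact hI.norm
  rw [setAverage_eq, setAverage_eq, smul_eq_mul, smul_eq_mul]
  calc _ ≤ (volume.real (Metric.ball x (θ * r)))⁻¹ *
        ((∫ y in Metric.ball x r, ‖u y - p y‖) + volume.real (Metric.ball x (θ * r)) * D) := by gcongr
    _ = _ := by
      rw [mul_add, inv_mul_cancel_left₀ hv'.ne', volume_real_ball x hθr, volume_real_ball x hr, mul_pow]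
      field_simp

omit [InnerProductSpace ℝ W] [FiniteDimensional ℝ W] in
theorem tendsto_density_of_notMem_densitySet {Ω : Set (EuclideanSpace ℝ (Fin n))}
    {μ : VectorMeasure (EuclideanSpace ℝ (Fin n)) W} {x : EuclideanSpace ℝ (Fin n)}
    (hx : x ∈ Ω \ densitySet Ω μ) :
    Tendsto (fun r : ℝ => μ.variation.real (Metric.ball x r) / r ^ (n - 1)) (𝓝[>] 0) (𝓝 0) := by
  have h0 : limsup (fun r : ℝ =>
      μ.variation (Metric.ball x r) / ENNReal.ofReal (r ^ (n - 1))) (𝓝[>] 0) ≤ 0 := by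
    by_contra h
    exact hx.2 ⟨hx.1, not_le.1 h⟩
  have h1 := tendsto_of_le_liminf_of_limsup_le (bot_le : (0 : ℝ≥0∞) ≤ _) h0
  have h2 := (ENNReal.tendsto_toReal ENNReal.zero_ne_top).comp h1
  rw [ENNReal.toReal_zero] at h2
  refine h2.congr' ?_
  filter_upwards [self_mem_nhdsWithin] with r hr
  have hr' : 0 < r := hr
  rw [Function.comp_apply, ENNReal.toReal_div, ENNReal.toReal_ofReal (by positivity), measureReal_def]

omit [InnerProductSpace ℝ V] [FiniteDimensional ℝ V] in
theorem meanOsc_bounded {Ω : Set (EuclideanSpace ℝ (Fin n))}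
    {u : EuclideanSpace ℝ (Fin n) → V} (hu : IntegrableOn u Ω)
    {x : EuclideanSpace ℝ (Fin n)} {ρ θ : ℝ} (hρ : 0 < ρ) (hθ : 0 < θ) (hΩ : Metric.ball x ρ ⊆ Ω) :
    ∃ M, ∀ r, θ * ρ ≤ r → r ≤ ρ → meanOsc u x r ≤ M := by
  refine ⟨(volume.real (Metric.ball x (θ * ρ)))⁻¹ * ∫ y in Metric.ball x ρ, ‖u y - 0‖,
    fun r h1 h2 => (meanOsc_le u x r 0).trans ?_⟩
  have hI := (integrableOn_ball_sub hu hΩ (p := fun _ => (0 : V)) continuous_const).norm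
  have hv := volume_real_ball_pos x (mul_pos hθ hρ)
  rw [setAverage_eq, smul_eq_mul]
  exact mul_le_mul (inv_anti₀ hv (measureReal_mono (Metric.ball_subset_ball h1)
      measure_ball_lt_top.ne))
    (setIntegral_mono_set hI (Eventually.of_forall fun _ => norm_nonneg _)
      (Metric.ball_subset_ball h2).eventuallyLE)
    (integral_nonneg fun _ => norm_nonneg _) (inv_nonneg.2 hv.le)

theorem IsBVWithGradient.average_norm_sub_le (hn : 1 ≤ n) {B : Fin n → V →ₗ[ℝ] W} {f : TestSpace n}
    (hf : ∫ z, f.1 z = 1) {L : ℕ} {C : ℝ} (hC : 0 ≤ C) (hB : HasPotentials B f L C)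
    {c : (Fin n → ℕ) → TestSpace n} (hc : ∀ y, TestSpace.taylorKernel f L y =
      ∑ β ∈ multiIndices n (L + 1), (∏ i, y i ^ β i) • c β)
    {Ω : Set (EuclideanSpace ℝ (Fin n))} (hΩo : IsOpen Ω) {u : EuclideanSpace ℝ (Fin n) → V}
    {μ : VectorMeasure (EuclideanSpace ℝ (Fin n)) W} (hu : IsBVWithGradient B Ω u μ)
    {x : EuclideanSpace ℝ (Fin n)} {r : ℝ} (hr : 0 < r) (hΩ : Metric.ball x r ⊆ Ω) :
    ⨍ y in Metric.ball x r, ‖u y - centredPolynomial (L + 1) x (taylorCoeff c Ω u x r) y‖ ≤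
      (Module.finrank ℝ V * C * 2 ^ n * 2 ^ n * 2) *
        (μ.variation.real (Metric.ball x r) / r ^ (n - 1)) := by
  have := isFiniteMeasure_variation μ
  have h := hu.lintegral_enorm_sub_le hf hC hB hΩo hr hΩ
  simp only [taylorAverage_one_eq hc hu.integrableOn] at h
  have hI := integrableOn_ball_sub hu.integrableOn hΩ
    (continuous_centredPolynomial (L + 1) x (taylorCoeff c Ω u x r))
  have hv := volume_real_ball_pos (n := n) 0 one_pos
  have h1 : ∫ y in Metric.ball x r,
      ‖u y - centredPolynomial (L + 1) x (taylorCoeff c Ω u x r) y‖ ≤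
        (Module.finrank ℝ V * C * 2 ^ n * 2 ^ n *
        volume.real (Metric.ball (0 : EuclideanSpace ℝ (Fin n)) 1) * 2 * r) *
        μ.variation.real (Metric.ball x r) := by
    rw [integral_norm_eq_lintegral_enorm hI.aestronglyMeasurable]
    refine (ENNReal.toReal_mono (by finiteness) h).trans_eq ?_
    rw [ENNReal.toReal_mul, ENNReal.toReal_ofReal (by positivity)]
    rfl
  rw [setAverage_eq, smul_eq_mul, volume_real_ball x hr]
  -- For `n ≥ 1` the truncated subtraction is genuine and `r / r^n = 1 / r^(n-1)`.
  obtain ⟨m, rfl⟩ : ∃ m, n = m + 1 := ⟨n - 1, by omega⟩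
  refine (mul_le_mul_of_nonneg_left h1 (by positivity)).trans_eq ?_
  rw [Nat.add_sub_cancel, pow_succ r]
  field_simp

end

end QuasiCont

/-! ### Conclusion: choice of constants and iteration. -/

theorem proposition1p7 {n : ℕ} (hn : 1 ≤ n) {V W : Type*}
    [NormedAddCommGroup V] [InnerProductSpace ℝ V] [FiniteDimensional ℝ V]
    [NormedAddCommGroup W] [InnerProductSpace ℝ W] [FiniteDimensional ℝ W]
    (B : Fin n → V →ₗ[ℝ] W) (hB : QuasiCont.IsCElliptic B) :
    ∃ (ℓ : ℕ) (c : ℝ), 0 < c ∧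
      ∀ (Ω : Set (EuclideanSpace ℝ (Fin n))), IsOpen Ω →
      ∀ (u : EuclideanSpace ℝ (Fin n) → V) (μ : VectorMeasure (EuclideanSpace ℝ (Fin n)) W),
        QuasiCont.IsBVWithGradient B Ω u μ →
        (∃ a : EuclideanSpace ℝ (Fin n) → ℝ → (Fin n → ℕ) → V,
          (∀ x ∈ Ω, ∀ r : ℝ, 0 < r → Metric.ball x r ⊆ Ω →
            ⨍ y in Metric.ball x r, ‖u y - QuasiCont.centredPolynomial ℓ x (a x r) y‖
              ≤ c * (μ.variation.real (Metric.ball x r) / r ^ (n - 1))) ∧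
          (∀ x ∈ Ω \ QuasiCont.densitySet Ω μ, ∀ β : Fin n → ℕ,
            1 ≤ ∑ i, β i → ∑ i, β i < ℓ →
              Tendsto (fun r : ℝ => r ^ (∑ i, β i) • a x r β) (𝓝[>] 0) (𝓝 0))) ∧
        (∀ x ∈ Ω \ QuasiCont.densitySet Ω μ,
          Tendsto (fun r : ℝ => ⨅ z : V, ⨍ y in Metric.ball x r, ‖u y - z‖)
            (𝓝[>] 0) (𝓝 0)) := by
  open QuasiCont in
  obtain ⟨L, C, hC, hpot⟩ := hB.exists_potential (TestSpace.bump n)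
  obtain ⟨k, hk0, hk⟩ := TestSpace.exists_taylorKernel_eq_sum (TestSpace.bump n) L
  choose M hM0 hM using fun β => TestSpace.exists_bound (k β)
  set c : ℝ := Module.finrank ℝ V * C * 2 ^ n * 2 ^ n * 2 with hc
  have hc0 : 0 ≤ c := by positivity
  -- `c` may vanish, for instance if `V` is trivial; `c + 1` is positive.
  refine ⟨L + 1, c + 1, by positivity, fun Ω hΩo u μ hu => ?_⟩
  have hP : ∀ x : EuclideanSpace ℝ (Fin n), ∀ r : ℝ, 0 < r → Metric.ball x r ⊆ Ω →
      ⨍ y in Metric.ball x r, ‖u y - centredPolynomial (L + 1) x (taylorCoeff k Ω u x r) y‖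
        ≤ c * (μ.variation.real (Metric.ball x r) / r ^ (n - 1)) := fun x r hr hΩ =>
    hu.average_norm_sub_le hn (TestSpace.integral_bump n) hC hpot hk hΩo hr hΩ
  set κ := volume.real (Metric.ball (0 : EuclideanSpace ℝ (Fin n)) 1) with hκ
  have hκ0 : 0 < κ := volume_real_ball_pos 0 one_pos
  set N : ℝ := (∑ β ∈ multiIndices n (L + 1), M β) * κ with hN
  have hN0 : 0 ≤ N := mul_nonneg (Finset.sum_nonneg fun β _ => hM0 β) hκ0.le
  have hcoef : ∀ x : EuclideanSpace ℝ (Fin n), ∀ r : ℝ, 0 < r → Metric.ball x r ⊆ Ω →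
      ∀ β ∈ multiIndices n (L + 1), β ≠ 0 →
        ‖r ^ (∑ i, β i) • taylorCoeff k Ω u x r β‖ ≤ N * meanOsc u x r := by
    intro x r hr hΩ β hβ hβ0
    refine (norm_smul_taylorCoeff_le (hk0 β hβ0) (hM β) hΩo hu.integrableOn hr hΩ).trans ?_
    refine mul_le_mul_of_nonneg_right (mul_le_mul_of_nonneg_right ?_ hκ0.le) (meanOsc_nonneg _ _ _)
    exact Finset.single_le_sum (fun β _ => hM0 β) hβ
  have hosc : ∀ x ∈ Ω \ densitySet Ω μ, Tendsto (meanOsc u x) (𝓝[>] 0) (𝓝 0) := by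
    intro x hx
    obtain ⟨r₀, hr₀, hball⟩ := Metric.isOpen_iff.1 hΩo x hx.1
    set S : ℝ := ((multiIndices n (L + 1)).card : ℝ) with hS
    have hS0 : 0 ≤ S := Nat.cast_nonneg _
    have hSN : 0 ≤ S * N := mul_nonneg hS0 hN0
    -- Chosen so that `S θ N ≤ 1/2`: the polynomial part then contributes at most half the
    -- oscillation at radius `r`.
    set θ : ℝ := (2 * (S * N + 1))⁻¹ with hθ
    have hθ0 : 0 < θ := by positivity
    have hθ1 : θ < 1 := inv_lt_one_of_one_lt₀ (by linarith)
    have hθS : S * (θ * N) ≤ 1 / 2 := by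
      rw [hθ, show S * ((2 * (S * N + 1))⁻¹ * N) = (S * N) / (2 * (S * N + 1)) by ring,
        div_le_iff₀ (by positivity)]
      linarith
    have hlim := ((tendsto_density_of_notMem_densitySet hx).const_mul c).const_mul ((θ ^ n)⁻¹)
    rw [mul_zero, mul_zero] at hlim
    refine tendsto_zero_of_dilation_le hθ0 hθ1 hr₀ (meanOsc_nonneg u x) hlim (fun r hr hr' => ?_)
      (fun ρ hρ hρ' => meanOsc_bounded hu.integrableOn hρ hθ0
        ((Metric.ball_subset_ball hρ'.le).trans hball))
    have hΩ : Metric.ball x r ⊆ Ω := (Metric.ball_subset_ball hr'.le).trans hball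
    have hm := meanOsc_nonneg u x r
    refine (meanOsc_le_of_centredPolynomial hu.integrableOn hr hΩ hθ0 hθ1.le
      (mul_nonneg hN0 hm) (hcoef x r hr hΩ)).trans ?_
    have h1 := hP x r hr hΩ
    have h2 : ((multiIndices n (L + 1)).card : ℝ) * (θ * (N * meanOsc u x r)) ≤ meanOsc u x r / 2 := by
      calc _ = S * (θ * N) * meanOsc u x r := by ring
        _ ≤ 1 / 2 * meanOsc u x r := by gcongr
        _ = _ := by ring
    rw [add_comm]
    gcongr
  refine ⟨⟨taylorCoeff k Ω u, fun x _ r hr hΩ => (hP x r hr hΩ).trans ?_, fun x hx β hβ1 hβ2 => ?_⟩,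
    hosc⟩
  · gcongr
    linarith
  · obtain ⟨r₀, hr₀, hball⟩ := Metric.isOpen_iff.1 hΩo x hx.1
    have hlim := (hosc x hx).const_mul N
    rw [mul_zero] at hlim
    refine squeeze_zero_norm' ?_ hlim
    filter_upwards [Ioo_mem_nhdsGT hr₀] with r hr
    refine hcoef x r hr.1 ((Metric.ball_subset_ball hr.2.le).trans hball) β
      (mem_multiIndices.2 hβ2) ?_
    rintro rfl
    simp at hβ1
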